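/- Let $Q:\mathbb{R}^n\to\mathbb{R}^n$ be self-adjoint positive semidefinite, $c\in\mathbb{R}^n$, $A:\mathbb{R}^n\to\mathbb{R}^m$ linear, $\phi:\mathbb{R}^n\to(-\infty,+\infty]$ proper, closed and convex, and $\mathcal{K}=\{v\in\mathbb{R}^m : l_i\le v_i\le u_i,\ 1\le i\le m\}$ nonempty, with $l_i,u_i\in[-\infty,+\infty]$. Consider the convex composite quadratic program $\min\{\frac12\langle x,Qx\rangle+\langle c,x\rangle+\phi(x) : Ax\in\mathcal{K}\}$ and, with $\mathcal{W}=\operatorname{Range}(Q)$, its restricted Wolfe dual $$\min_{(y,w,z)\in\mathbb{R}^m\times\mathcal{W}\times\mathbb{R}^n}\Big\{\tfrac12\langle w,Qw\rangle+\delta_{\mathcal{K}}^*(-y)+\phi^*(-z) : -Qw+A^*y+z=c\Big\}.$$ Let $u^*=(y^*,w^*,z^*,x^*)\in\mathbb{R}^m\times\mathcal{W}\times\mathbb{R}^n\times\mathbb{R}^n$ be a solution (assumed to exist) of the KKT system $$Qw^*-Qx^*=0,\quad Ax^*\in\partial\delta_{\mathcal{K}}^*(-y^*),\quad x^*\in\partial\phi^*(-z^*),\quad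 -Qw^*+A^*y^*+z^*-c=0.$$ Let $\sigma>0$, let $\lambda_Q>0$ be at least the largest eigenvalue of $Q$, put $\mathcal{S}_w=Q(\lambda_Q I_n-Q)$, and let $\mathcal{S}_y$ be a self-adjoint positive semidefinite operator on $\mathbb{R}^m$ such that $\mathcal{S}_y+AA^*$ is positive definite. For a self-adjoint positive semidefinite $\mathcal{T}$ write $\|v\|_{\mathcal{T}}=\sqrt{\langle v,\mathcal{T}v\rangle}$. Starting from an arbitrary $u_Q^0=(y^0,w_Q^0,z^0,x^0)\in\mathbb{R}^m\times\mathbb{R}^n\times\mathbb{R}^n\times\mathbb{R}^n$, let $u_Q^k=(y^k,w_Q^k,z^k,x^k)$ and $\bar u_Q^{k}=(\bar y^{k},\bar w_Q^{k},\bar z^{k},\bar x^{k})$ be generated, for $k=0,1,2,\dots$, as follows, where $r(y,w,z)=-Qw+A^*y+z-c$: 1. $\bar z^{k+1}=\arg\min_{z}\{\phi^*(-z)+\langle x^k,r(y^k,w_Q^k,z)\rangle+\frac\sigma2\|r(y^k,w_Q^k,z)\|^2\}$; 2. $\bar x^{k+1}=x^k+\sigma\, r(y^k,w_Q^k,\bar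 z^{k+1})$; 3. $\bar w_Q^{k+1/2}=\frac1{1+\sigma\lambda_Q}\big(\sigma\lambda_Qw_Q^k+\bar x^{k+1}+\sigma\, r(y^k,w_Q^k,\bar z^{k+1})\big)$; 4. $\bar y^{k+1}=\arg\min_{y}\{\delta_{\mathcal{K}}^*(-y)+\langle\bar x^{k+1},r(y,\bar w_Q^{k+1/2},\bar z^{k+1})\rangle+\frac\sigma2\|r(y,\bar w_Q^{k+1/2},\bar z^{k+1})\|^2+\frac\sigma2\|y-y^k\|_{\mathcal{S}_y}^2\}$; 5. $\bar w_Q^{k+1}=\frac1{1+\sigma\lambda_Q}\big(\sigma\lambda_Qw_Q^k+\bar x^{k+1}+\sigma\, r(\bar y^{k+1},w_Q^k,\bar z^{k+1})\big)$; 6. $\hat u_Q^{k+1}=2\bar u_Q^{k+1}-u_Q^k$ and $u_Q^{k+1}=\frac1{k+2}u_Q^0+\frac{k+1}{k+2}\hat u_Q^{k+1}$. Let $A_Q=[A^*\ \ -Q]$, that is $A_Q(y,w)=A^*y-Qw$, let $\mathcal{S}=\sigma\operatorname{diag}(\mathcal{S}_y,\mathcal{S}_w)$ and $\widehat{\mathcal{S}}_{\rm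 sGS}=\operatorname{diag}\big(\sigma^2AQ(\sigma Q^2+Q+\sigma\mathcal{S}_w)^{-1}QA^*,\,0\big)$, where the inverse is taken on $\mathcal{W}$, and let, with respect to the blocks $(y,w),z,x$, $$\mathcal{M}=\begin{bmatrix}\sigma A_Q^*A_Q+\mathcal{S}+\widehat{\mathcal{S}}_{\rm sGS}&0&A_Q^*\\0&0&0\\A_Q&0&\frac1\sigma I_n\end{bmatrix}.$$ For $u=(y,w,z,x)$ let $$\mathcal{R}(u)=\big(Ax-\Pi_{\mathcal{K}}(Ax-y),\ Qw-Qx,\ x-\operatorname{Prox}_\phi(x-z),\ c-A^*y+Qw-z\big),$$ and let $h(y,w,z)=\frac12\langle w,Qw\rangle+\delta_{\mathcal{K}}^*(-y)+\phi^*(-z)-\big(\frac12\langle w^*,Qw^*\rangle+\delta_{\mathcal{K}}^*(-y^*)+\phi^*(-z^*)\big)$ be the dual objective error. Then, with $R_0=\|u_Q^0-u^*\|_{\mathcal{M}}$, for all $k\ge0$: $$\|\bar u_Q^{k+1}-u_Q^k\|_{\mathcal{M}}\le\frac{R_0}{k+1},$$ $$\|\mathcal{R}(\bar u_Q^{k+1})\|\le\Big(\frac{\sigma\|A_Q^*\|+1}{\sqrt\sigma}+\big\|\sqrt{\mathcal{S}+\widehat{\mathcal{S}}_{\rm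 sGS}}\big\|\Big)\frac{R_0}{k+1},$$ $$-\frac{\|x^*\|}{\sqrt\sigma}\cdot\frac{R_0}{k+1}\le h(\bar y^{k+1},\bar w_Q^{k+1},\bar z^{k+1})\le\Big(3R_0+\frac{\|x^*\|}{\sqrt\sigma}\Big)\frac{R_0}{k+1}.$$ -/

import Mathlib

open scoped InnerProductSpace

noncomputable section

namespace DualHPR

/-! ### Spaces -/

/-- The Euclidean space `ℝⁿ`. -/
abbrev Vec (n : ℕ) := EuclideanSpace ℝ (Fin n)

/-- The Euclidean product `ℝᵐ × ℝⁿ` of the pairs `(y, w)`. -/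
abbrev VSp (m n : ℕ) := WithLp 2 (Vec m × Vec n)

/-- The Euclidean product `ℝᵐ × ℝⁿ × ℝⁿ × ℝⁿ` of the tuples `u = (y, w, z, x)`. -/
abbrev USp (m n : ℕ) := WithLp 2 (VSp m n × WithLp 2 (Vec n × Vec n))

variable {m n : ℕ}

/-- The tuple `(y, w, z, x)`. -/
def mkU (y : Vec m) (w z x : Vec n) : USp m n :=
  WithLp.toLp 2 (WithLp.toLp 2 (y, w), WithLp.toLp 2 (z, x))

/-- The component `y` of `u = (y, w, z, x)`. -/
def yOf (u : USp m n) : Vec m := u.fst.fst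
/-- The component `w` of `u = (y, w, z, x)`. -/
def wOf (u : USp m n) : Vec n := u.fst.snd
/-- The component `z` of `u = (y, w, z, x)`. -/
def zOf (u : USp m n) : Vec n := u.snd.fst
/-- The component `x` of `u = (y, w, z, x)`. -/
def xOf (u : USp m n) : Vec n := u.snd.snd

/-! ### Convex analysis for extended-real-valued functions -/

section Convex

variable {E : Type*} [NormedAddCommGroup E] [InnerProductSpace ℝ E]

/-- `f : E → (-∞, +∞]` is proper: it never takes the value `-∞` and is not identically `+∞`. -/
def ProperFun (f : E → EReal) : Prop := (∀ x, f x ≠ ⊥) ∧ ∃ x, f x ≠ ⊤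

/-- `f` is convex: its epigraph is a convex set. -/
def ConvexFun (f : E → EReal) : Prop := Convex ℝ {p : E × ℝ | f p.1 ≤ (p.2 : EReal)}

/-- The indicator function `δ_C`. -/
def indicatorFun (C : Set E) : E → EReal := by
  classical exact fun x => if x ∈ C then 0 else ⊤

/-- The convex conjugate `f*(s) = sup_x {⟨x, s⟩ - f x}`. -/
def conjFun (f : E → EReal) (s : E) : EReal := ⨆ x : E, (((⟪x, s⟫_ℝ : ℝ) : EReal) - f x)

/-- The subdifferential `∂f(x)`. -/
def subdiff (f : E → EReal) (x : E) : Set E :=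
  {s | ∀ y, f x + ((⟪s, y - x⟫_ℝ : ℝ) : EReal) ≤ f y}

/-- `Prox_f(x) = argmin_z {f z + ‖z - x‖² / 2}`. -/
def prox (f : E → EReal) (x : E) : E :=
  Classical.epsilon fun p => IsMinOn (fun z => f z + ((1 / 2 * ‖z - x‖ ^ 2 : ℝ) : EReal)) Set.univ p

/-- The Euclidean projection `Π_C(x) = argmin_{z ∈ C} ‖x - z‖`. -/
def projSet (C : Set E) (x : E) : E :=
  Classical.epsilon fun p => p ∈ C ∧ IsMinOn (fun z => ‖x - z‖) C p

/-- The seminorm `‖x‖_T = √⟨x, T x⟩` of a self-adjoint positive semidefinite operator `T`. -/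
def opSeminorm (T : E →L[ℝ] E) (x : E) : ℝ := √(⟪x, T x⟫_ℝ)

/-- The square root of a self-adjoint positive semidefinite operator `T`: the self-adjoint
positive semidefinite operator whose square is `T`. -/
def opSqrt (T : E →L[ℝ] E) : E →L[ℝ] E :=
  Classical.epsilon fun R => R.IsPositive ∧ R ∘L R = T

theorem opSqrt_spec [FiniteDimensional ℝ E] (T : E →L[ℝ] E) (hT : T.IsPositive) :
    (opSqrt T).IsPositive ∧ opSqrt T ∘L opSqrt T = T := by
  refine Classical.epsilon_spec (p := fun R : E →L[ℝ] E => R.IsPositive ∧ R ∘L R = T) ?_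
  have hs := hT.isSymmetric
  let e := hs.eigenvectorBasis rfl
  let ev := hs.eigenvalues rfl
  let R : E →L[ℝ] E := ∑ i, √(ev i) • InnerProductSpace.rankOne ℝ (e i) (e i)
  have hR : ∀ j, R (e j) = √(ev j) • e j := by
    intro j
    simp only [R, sum_apply, smul_apply,
      InnerProductSpace.rankOne_apply, orthonormal_iff_ite.mp e.orthonormal]
    simp
  refine ⟨R, ContinuousLinearMap.isPositive_sum _ fun i _ =>
    (InnerProductSpace.isPositive_rankOne_self (e i)).smul_of_nonneg (Real.sqrt_nonneg _), ?_⟩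
  apply ContinuousLinearMap.coe_injective
  refine e.toBasis.ext fun j => ?_
  have h0 : 0 ≤ ev j := hT.toLinearMap.nonneg_eigenvalues rfl j
  have h1 : T (e j) = ev j • e j := hs.apply_eigenvectorBasis rfl j
  have h2 : R (R (e j)) = T (e j) := by
    rw [hR, map_smul, hR, smul_smul, Real.mul_self_sqrt h0, h1]
  simpa using h2

end Convex

/-! ### The problem -/

/-- The data of the convex composite quadratic program
`min {⟨x, Q x⟩ / 2 + ⟨c, x⟩ + φ x | A x ∈ K}`, `K = {v | lo ≤ v ≤ hi}`: the operator `Q` is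
self-adjoint positive semidefinite, `φ` is proper, closed and convex, and `K` is nonempty. -/
structure CCQP (m n : ℕ) where
  Q : Vec n →L[ℝ] Vec n
  c : Vec n
  φ : Vec n → EReal
  A : Vec n →L[ℝ] Vec m
  lo : Fin m → EReal
  hi : Fin m → EReal
  Q_pos : Q.IsPositive
  φ_proper : ProperFun φ
  φ_closed : LowerSemicontinuous φ
  φ_convex : ConvexFun φ
  K_nonempty : ∃ v : Vec m, ∀ i, lo i ≤ (v i : EReal) ∧ (v i : EReal) ≤ hi i

namespace CCQP

variable (P : CCQP m n)

/-- The set `K = {v | lo ≤ v ≤ hi}`. -/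
def K : Set (Vec m) := {v | ∀ i, P.lo i ≤ (v i : EReal) ∧ (v i : EReal) ≤ P.hi i}

/-- The adjoint `A*`. -/
def At : Vec m →L[ℝ] Vec n := ContinuousLinearMap.adjoint P.A

/-- The subspace `W = Range(Q)`. -/
def W : Submodule ℝ (Vec n) := LinearMap.range (P.Q : Vec n →ₗ[ℝ] Vec n)

/-- The support function `δ_K^*`. -/
def suppK : Vec m → EReal := conjFun (indicatorFun P.K)

/-- The conjugate `φ*`. -/
def φc : Vec n → EReal := conjFun P.φ

/-- The constraint residual `-Q w + A* y + z - c` of the restricted Wolfe dual. -/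
def res (y : Vec m) (w z : Vec n) : Vec n := -P.Q w + P.At y + z - P.c

/-- The objective `⟨w, Q w⟩ / 2 + δ_K^*(-y) + φ*(-z)` of the restricted Wolfe dual. -/
def dualObj (y : Vec m) (w z : Vec n) : EReal :=
  ((1 / 2 * ⟪w, P.Q w⟫_ℝ : ℝ) : EReal) + P.suppK (-y) + P.φc (-z)

/-- `u = (y, w, z, x)` solves the KKT system. -/
def IsKKT (u : USp m n) : Prop :=
  wOf u ∈ P.W ∧
  P.Q (wOf u) - P.Q (xOf u) = 0 ∧
  P.A (xOf u) ∈ subdiff P.suppK (-yOf u) ∧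
  xOf u ∈ subdiff P.φc (-zOf u) ∧
  -P.Q (wOf u) + P.At (yOf u) + zOf u - P.c = 0

/-- The KKT residual mapping. -/
def kktResidual (u : USp m n) : USp m n :=
  mkU (P.A (xOf u) - projSet P.K (P.A (xOf u) - yOf u))
    (P.Q (wOf u) - P.Q (xOf u))
    (xOf u - prox P.φ (xOf u - zOf u))
    (P.c - P.At (yOf u) + P.Q (wOf u) - zOf u)

/-! ### The augmented Lagrangian and its subproblems -/

/-- The augmented Lagrangian `L_σ(y, w, z; x)`. -/
def augLag (σ : ℝ) (y : Vec m) (w z x : Vec n) : EReal :=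
  ((1 / 2 * ⟪w, P.Q w⟫_ℝ : ℝ) : EReal) + P.suppK (-y) + P.φc (-z)
    + ((⟪x, P.res y w z⟫_ℝ + σ / 2 * ‖P.res y w z‖ ^ 2 : ℝ) : EReal)

/-- The terms of `L_σ(y, w, z; x)` that contain `z`. The remaining terms are constant in `z`
(and may be `+∞`, since `-y` need not lie in the domain of `δ_K^*`). -/
def augLagZ (σ : ℝ) (y : Vec m) (w z x : Vec n) : EReal :=
  P.φc (-z) + ((⟪x, P.res y w z⟫_ℝ + σ / 2 * ‖P.res y w z‖ ^ 2 : ℝ) : EReal)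

/-- The terms of `L_σ(y, w, z; x)` that contain `y`. -/
def augLagY (σ : ℝ) (y : Vec m) (w z x : Vec n) : EReal :=
  P.suppK (-y) + ((⟪x, P.res y w z⟫_ℝ + σ / 2 * ‖P.res y w z‖ ^ 2 : ℝ) : EReal)

theorem augLag_eq_z (σ : ℝ) (y : Vec m) (w z x : Vec n) :
    P.augLag σ y w z x =
      (((1 / 2 * ⟪w, P.Q w⟫_ℝ : ℝ) : EReal) + P.suppK (-y)) + P.augLagZ σ y w z x := by
  simp only [augLag, augLagZ, add_assoc]

theorem augLag_eq_y (σ : ℝ) (y : Vec m) (w z x : Vec n) :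
    P.augLag σ y w z x =
      (((1 / 2 * ⟪w, P.Q w⟫_ℝ : ℝ) : EReal) + P.φc (-z)) + P.augLagY σ y w z x := by
  simp only [augLag, augLagY]
  ac_rfl

/-! ### The operators of the symmetric Gauss-Seidel metric

Operators on `ℝᵐ × W` are extended to `ℝᵐ × ℝⁿ` by the same formulas, since the iterates `w_Q`
of the algorithm lie in `ℝⁿ`. -/

/-- `A_Q = [A*  -Q]`. -/
def AQ : VSp m n →L[ℝ] Vec n :=
  P.At ∘L WithLp.fstL 2 ℝ (Vec m) (Vec n) - P.Q ∘L WithLp.sndL 2 ℝ (Vec m) (Vec n)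

/-- `A_Q^*`. -/
def AQt : Vec n →L[ℝ] VSp m n := ContinuousLinearMap.adjoint P.AQ

/-- `S_w = Q (λ_Q I - Q)`. -/
def Sw (lamQ : ℝ) : Vec n →L[ℝ] Vec n :=
  P.Q ∘L (lamQ • ContinuousLinearMap.id ℝ (Vec n) - P.Q)

/-- `σ Q² + Q + σ S_w`. -/
def wBlock (σ lamQ : ℝ) : Vec n →L[ℝ] Vec n :=
  σ • (P.Q ∘L P.Q) + P.Q + σ • P.Sw lamQ

theorem Q_mem_W (x : Vec n) : P.Q x ∈ P.W := ⟨x, rfl⟩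

theorem wBlock_apply (σ lamQ : ℝ) (w : Vec n) :
    P.wBlock σ lamQ w = (1 + σ * lamQ) • P.Q w := by
  simp only [wBlock, Sw, add_apply, smul_apply, ContinuousLinearMap.comp_apply, sub_apply,
    ContinuousLinearMap.id_apply, map_sub, map_smul, smul_sub, add_smul, mul_smul, one_smul]
  abel

theorem wBlock_mem_W (σ lamQ : ℝ) (w : Vec n) (_ : w ∈ P.W) :
    (P.wBlock σ lamQ : Vec n →ₗ[ℝ] Vec n) w ∈ P.W := by
  have h : (P.wBlock σ lamQ : Vec n →ₗ[ℝ] Vec n) w = (1 + σ * lamQ) • P.Q w :=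
    P.wBlock_apply σ lamQ w
  rw [h]
  exact P.W.smul_mem _ (P.Q_mem_W w)

/-- `σ Q² + Q + σ S_w` as an operator on `W`. -/
def wBlockW (σ lamQ : ℝ) : Module.End ℝ P.W :=
  LinearMap.restrict (P.wBlock σ lamQ : Vec n →ₗ[ℝ] Vec n) (P.wBlock_mem_W σ lamQ)

/-- `σ Q² + Q + σ S_w` is invertible on `W`, so that its `Ring.inverse` below is its inverse. -/
theorem isUnit_wBlockW {σ lamQ : ℝ} (hσ : 0 < σ) (hlam : 0 < lamQ) :
    IsUnit (P.wBlockW σ lamQ) := by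
  rw [LinearMap.isUnit_iff_ker_eq_bot, LinearMap.ker_eq_bot']
  rintro ⟨w, v, rfl⟩ hw
  have h1 : P.wBlock σ lamQ (P.Q v) = 0 := congrArg Subtype.val hw
  rw [wBlock_apply] at h1
  have h2 : P.Q (P.Q v) = 0 := (smul_eq_zero.mp h1).resolve_left (by positivity)
  have h3 : ⟪P.Q v, P.Q v⟫_ℝ = 0 := by
    rw [← P.Q_pos.inner_left_eq_inner_right, h2, inner_zero_left]
  exact Subtype.ext (inner_self_eq_zero.mp h3)

/-- `Q : ℝⁿ → W`. -/
def QtoW : Vec n →ₗ[ℝ] P.W := LinearMap.rangeRestrict (P.Q : Vec n →ₗ[ℝ] Vec n)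

/-- `Ŝ_sGS1 = σ² A Q (σ Q² + Q + σ S_w)⁻¹ Q A*`, the inverse being taken on `W`. -/
def SsGS1 (σ lamQ : ℝ) : Vec m →L[ℝ] Vec m :=
  σ ^ 2 • (P.A ∘L P.Q ∘L
    LinearMap.toContinuousLinearMap
      (P.W.subtype ∘ₗ Ring.inverse (P.wBlockW σ lamQ) ∘ₗ P.QtoW) ∘L P.At)

/-- The block-diagonal operator `diag(B, C)` on `ℝᵐ × ℝⁿ`. -/
def blockDiag (B : Vec m →L[ℝ] Vec m) (C : Vec n →L[ℝ] Vec n) : VSp m n →L[ℝ] VSp m n :=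
  ((WithLp.prodContinuousLinearEquiv 2 ℝ (Vec m) (Vec n)).symm :
      (Vec m × Vec n) →L[ℝ] VSp m n) ∘L
    ((B ∘L WithLp.fstL 2 ℝ (Vec m) (Vec n)).prod (C ∘L WithLp.sndL 2 ℝ (Vec m) (Vec n)))

/-- `S = σ diag(S_y, S_w)`. -/
def S (σ lamQ : ℝ) (Sy : Vec m →L[ℝ] Vec m) : VSp m n →L[ℝ] VSp m n :=
  σ • blockDiag Sy (P.Sw lamQ)

/-- `Ŝ_sGS = diag(Ŝ_sGS1, 0)`. -/
def SsGS (σ lamQ : ℝ) : VSp m n →L[ℝ] VSp m n := blockDiag (P.SsGS1 σ lamQ) 0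

/-- `S + Ŝ_sGS`. -/
def T1 (σ lamQ : ℝ) (Sy : Vec m →L[ℝ] Vec m) : VSp m n →L[ℝ] VSp m n :=
  P.S σ lamQ Sy + P.SsGS σ lamQ

/-- The metric `M`, with block rows `(σ A_Q^* A_Q + S + Ŝ_sGS, 0, A_Q^*)`, `(0, 0, 0)` and
`(A_Q, 0, I / σ)` with respect to the blocks `(y, w)`, `z`, `x`. -/
def metric (σ lamQ : ℝ) (Sy : Vec m →L[ℝ] Vec m) : USp m n →L[ℝ] USp m n :=
  let v : USp m n →L[ℝ] VSp m n := WithLp.fstL 2 ℝ (VSp m n) (WithLp 2 (Vec n × Vec n))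
  let x : USp m n →L[ℝ] Vec n :=
    WithLp.sndL 2 ℝ (Vec n) (Vec n) ∘L WithLp.sndL 2 ℝ (VSp m n) (WithLp 2 (Vec n × Vec n))
  let rowV : USp m n →L[ℝ] VSp m n := (σ • (P.AQt ∘L P.AQ) + P.T1 σ lamQ Sy) ∘L v + P.AQt ∘L x
  let rowX : USp m n →L[ℝ] Vec n := P.AQ ∘L v + σ⁻¹ • x
  ((WithLp.prodContinuousLinearEquiv 2 ℝ (VSp m n) (WithLp 2 (Vec n × Vec n))).symm :
      (VSp m n × WithLp 2 (Vec n × Vec n)) →L[ℝ] USp m n) ∘L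
    (rowV.prod
      (((WithLp.prodContinuousLinearEquiv 2 ℝ (Vec n) (Vec n)).symm :
          (Vec n × Vec n) →L[ℝ] WithLp 2 (Vec n × Vec n)) ∘L
        ((0 : USp m n →L[ℝ] Vec n).prod rowX)))

/-! ### The algorithm -/

/-- The sequences `u k = (yᵏ, w_Qᵏ, zᵏ, xᵏ)`, `ubar k = (ȳᵏ, w̄_Qᵏ, z̄ᵏ, x̄ᵏ)`, `uhat k = ûᵏ` and
`whalf k = w̄_Q^{k+1/2}` are generated by the easy-to-implement dual HPR method started at `u 0`
(the values `ubar 0` and `uhat 0` play no role). -/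
structure IsHPRSeq (σ lamQ : ℝ) (Sy : Vec m →L[ℝ] Vec m)
    (u ubar uhat : ℕ → USp m n) (whalf : ℕ → Vec n) : Prop where
  step1 : ∀ k, IsMinOn (fun z => P.augLagZ σ (yOf (u k)) (wOf (u k)) z (xOf (u k)))
    Set.univ (zOf (ubar (k + 1)))
  step2 : ∀ k, xOf (ubar (k + 1)) =
    xOf (u k) + σ • (-P.Q (wOf (u k)) + P.At (yOf (u k)) + zOf (ubar (k + 1)) - P.c)
  step3_1 : ∀ k, whalf k =
    (1 / (1 + σ * lamQ)) • ((σ * lamQ) • wOf (u k) + xOf (ubar (k + 1))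
      + σ • (-P.Q (wOf (u k)) + P.At (yOf (u k)) + zOf (ubar (k + 1)) - P.c))
  step3_2 : ∀ k, IsMinOn
    (fun y => P.augLagY σ y (whalf k) (zOf (ubar (k + 1))) (xOf (ubar (k + 1)))
      + ((σ / 2 * opSeminorm Sy (y - yOf (u k)) ^ 2 : ℝ) : EReal))
    Set.univ (yOf (ubar (k + 1)))
  step3_3 : ∀ k, wOf (ubar (k + 1)) =
    (1 / (1 + σ * lamQ)) • ((σ * lamQ) • wOf (u k) + xOf (ubar (k + 1))
      + σ • (-P.Q (wOf (u k)) + P.At (yOf (ubar (k + 1))) + zOf (ubar (k + 1)) - P.c))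
  step4 : ∀ k, uhat (k + 1) = (2 : ℝ) • ubar (k + 1) - u k
  step5 : ∀ k : ℕ, u (k + 1) =
    (1 / ((k : ℝ) + 2)) • u 0 + (((k : ℝ) + 1) / ((k : ℝ) + 2)) • uhat (k + 1)

/-- The objective error `h(y, w, z)` relative to the dual solution `(y*, w*, z*)` of `ustar`. -/
def objError (ustar : USp m n) (y : Vec m) (w z : Vec n) : EReal :=
  P.dualObj y w z - P.dualObj (yOf ustar) (wOf ustar) (zOf ustar)

end CCQP

end DualHPR

end

/-!
One step of the method, from `u = u k` to `ū = ubar (k + 1)`, is a resolvent step in the degenerate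
metric `M`: the optimality conditions of the subproblems say that `ū` solves the KKT system with
its right-hand side perturbed by `M (ū - u)` (`IsHPRSeq.isPerturbedKKT`). The explicit double pass
over `w` around the update of `y` contributes the term `Ŝ_sGS`, because `σ Q² + Q + σ S_w` is
`(1 + σ λ_Q) Q`. The KKT operator is monotone (`IsPerturbedKKT.inner_sub_nonpos`) and `M` is
positive semidefinite, so after applying `√M` the relaxed and anchored steps form a Halpern
iteration for a firmly nonexpansive map. Its potential
`k (k + 1) ‖g k‖² + (k + 1) ⟪g k, a k - a 0⟫`, with `g k = a k - b k`, does not increase, which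
gives the rate `R₀ / (k + 1)` for `‖ū - u‖_M` and the bound `‖ū - u*‖_M ≤ R₀` (`halpern_bounds`).

The remaining estimates express everything through `e = M (ū - u)`.

* The KKT residual at `ū` is bounded blockwise by `e`: the inversion rule `(∂f*)⁻¹ ⊆ ∂f`
  (`mem_subdiff_of_mem_subdiff_conjFun`) makes the `z`-block vanish and exhibits a fixed point of
  the projection in the `y`-block, where nonexpansiveness of `I - Π_K` applies. The quadratic form
  `⟪d, M d⟫ = ‖σ A_Q d_v + d_x‖² / σ + ⟪d_v, (S + Ŝ_sGS) d_v⟫` then bounds `e` by `‖ū - u‖_M`.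
* The subgradient inequalities at `ū` and at `u*` (`IsPerturbedKKT.dualObj_le`) place the objective
  error between `-⟪x*, e_x⟫` and `-⟪e, ū - u*⟫ - ⟪x*, e_x⟫`.
-/

namespace DualHPR

/-! ### Extended-real-valued functions and indicators -/

section Extended

variable {E : Type*}

theorem coe_sub_le_coe_iff (a r : ℝ) (b : EReal) :
    (a : EReal) - b ≤ r ↔ ((a - r : ℝ) : EReal) ≤ b := by
  induction b with
  | bot =>
    rw [EReal.coe_sub_bot, top_le_iff, le_bot_iff]
    exact ⟨fun h => absurd h (EReal.coe_ne_top _), fun h => absurd h (EReal.coe_ne_bot _)⟩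
  | top => simp
  | coe b =>
    norm_cast
    constructor <;> intro h <;> linarith

theorem ProperFun.exists_coe {f : E → EReal} (hf : ProperFun f) :
    ∃ (x : E) (r : ℝ), f x = r := by
  obtain ⟨x, hx⟩ := hf.2
  exact ⟨x, (f x).toReal, (EReal.coe_toReal hx (hf.1 x)).symm⟩

theorem indicatorFun_of_mem {C : Set E} {x : E} (hx : x ∈ C) : indicatorFun C x = 0 := by
  simp [indicatorFun, hx]

theorem indicatorFun_of_notMem {C : Set E} {x : E} (hx : x ∉ C) : indicatorFun C x = ⊤ := by
  simp [indicatorFun, hx]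

theorem indicatorFun_le_coe_iff {C : Set E} {x : E} {r : ℝ} :
    indicatorFun C x ≤ r ↔ x ∈ C ∧ 0 ≤ r := by
  by_cases hx : x ∈ C
  · simp [indicatorFun_of_mem hx, hx]
  · simp [indicatorFun_of_notMem hx, hx]

theorem properFun_indicatorFun {C : Set E} (hC : C.Nonempty) : ProperFun (indicatorFun C) := by
  refine ⟨fun x => ?_, ?_⟩
  · by_cases hx : x ∈ C
    · simp [indicatorFun_of_mem hx]
    · simp [indicatorFun_of_notMem hx]
  · obtain ⟨x, hx⟩ := hC
    exact ⟨x, by simp [indicatorFun_of_mem hx]⟩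

theorem lowerSemicontinuous_indicatorFun [TopologicalSpace E] {C : Set E} (hC : IsClosed C) :
    LowerSemicontinuous (indicatorFun C) := by
  intro x a ha
  change a < indicatorFun C x at ha
  change ∀ᶠ y in nhds x, a < indicatorFun C y
  by_cases hx : x ∈ C
  · rw [indicatorFun_of_mem hx] at ha
    refine Filter.Eventually.of_forall fun y => ?_
    by_cases hy : y ∈ C
    · rwa [indicatorFun_of_mem hy]
    · rw [indicatorFun_of_notMem hy]
      exact ha.trans_le le_top
  · filter_upwards [hC.isOpen_compl.mem_nhds hx] with y hy
    rw [indicatorFun_of_notMem hx] at ha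
    rwa [indicatorFun_of_notMem hy]

end Extended

/-! ### Conjugates, subgradients and proximal points -/

section ConvexAnalysis

variable {E : Type*} [NormedAddCommGroup E] [InnerProductSpace ℝ E]

theorem conjFun_le_coe_iff {f : E → EReal} {s : E} {r : ℝ} :
    conjFun f s ≤ r ↔ ∀ x, ((⟪x, s⟫_ℝ - r : ℝ) : EReal) ≤ f x := by
  simp only [conjFun, iSup_le_iff, coe_sub_le_coe_iff]

theorem ProperFun.exists_coe_of_mem_subdiff {f : E → EReal} (hf : ProperFun f) {x s : E}
    (hs : s ∈ subdiff f x) : ∃ r : ℝ, f x = r := by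
  obtain ⟨y, r, hy⟩ := hf.exists_coe
  have h := hs y
  refine ⟨(f x).toReal, (EReal.coe_toReal (fun hx => ?_) (hf.1 x)).symm⟩
  rw [hx, hy, EReal.top_add_coe] at h
  exact EReal.coe_ne_top r (top_le_iff.mp h)

theorem coe_le_of_mem_subdiff {f : E → EReal} {x s y : E} {a b : ℝ} (hs : s ∈ subdiff f x)
    (hx : f x = a) (hy : f y = b) : a + ⟪s, y - x⟫_ℝ ≤ b := by
  have h := hs y
  rw [hx, hy] at h
  exact_mod_cast h

theorem ProperFun.subdiff_monotone {f : E → EReal} (hf : ProperFun f) {x y s t : E}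
    (hs : s ∈ subdiff f x) (ht : t ∈ subdiff f y) : 0 ≤ ⟪s - t, x - y⟫_ℝ := by
  obtain ⟨a, ha⟩ := hf.exists_coe_of_mem_subdiff hs
  obtain ⟨b, hb⟩ := hf.exists_coe_of_mem_subdiff ht
  have h1 := coe_le_of_mem_subdiff hs ha hb
  have h2 := coe_le_of_mem_subdiff ht hb ha
  simp only [inner_sub_left, inner_sub_right] at h1 h2 ⊢
  linarith

theorem conjFun_ne_bot {f : E → EReal} (hf : ProperFun f) (s : E) : conjFun f s ≠ ⊥ := by
  obtain ⟨x, r, hx⟩ := hf.exists_coe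
  intro h
  have h1 : ((⟪x, s⟫_ℝ : ℝ) : EReal) - f x ≤ conjFun f s :=
    le_iSup (fun x : E => ((⟪x, s⟫_ℝ : ℝ) : EReal) - f x) x
  rw [h, hx, ← EReal.coe_sub] at h1
  exact EReal.coe_ne_bot _ (le_bot_iff.mp h1)

theorem mem_subdiff_neg_of_neg_mem {f : E → EReal} {z s : E}
    (h : -s ∈ subdiff (fun z => f (-z)) z) : s ∈ subdiff f (-z) := by
  intro y
  have := h (-y)
  rw [show -y - z = -(y - -z) by abel, inner_neg_neg] at this
  simpa using this

theorem convexFun_conjFun_neg (f : E → EReal) : ConvexFun fun s => conjFun f (-s) := by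
  rintro ⟨s, a⟩ hs ⟨t, b⟩ ht α β hα hβ hαβ
  simp only [Set.mem_ofPred_eq, conjFun_le_coe_iff, Prod.fst_add, Prod.snd_add, Prod.smul_fst,
    Prod.smul_snd] at hs ht ⊢
  intro x
  have h1 := hs x
  have h2 := ht x
  generalize f x = c at h1 h2 ⊢
  induction c with
  | bot => exact absurd (le_bot_iff.mp h1) (EReal.coe_ne_bot _)
  | top => simp
  | coe c =>
    norm_cast at h1 h2 ⊢
    simp only [inner_neg_right, inner_add_right, inner_smul_right, smul_eq_mul] at h1 h2 ⊢
    have : β = 1 - α := by linarith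
    subst this
    nlinarith [mul_le_mul_of_nonneg_left h1 hα, mul_le_mul_of_nonneg_left h2 hβ]

/-- A proper closed convex function has an affine minorant: separate a point strictly below the
graph, over a point of the domain, from the epigraph. -/
theorem exists_affine_minorant [CompleteSpace E] {f : E → EReal} (hf : ProperFun f)
    (hl : LowerSemicontinuous f) (hc : ConvexFun f) :
    ∃ (s : E) (r : ℝ), ∀ x, ((⟪x, s⟫_ℝ - r : ℝ) : EReal) ≤ f x := by
  obtain ⟨x₀, r₀, h₀⟩ := hf.exists_coe
  have hclosed : IsClosed {p : E × ℝ | f p.1 ≤ (p.2 : EReal)} :=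
    hl.isClosed_epigraph.preimage
      (continuous_fst.prodMk (continuous_coe_real_ereal.comp continuous_snd))
  have hnot : (x₀, r₀ - 1) ∉ {p : E × ℝ | f p.1 ≤ (p.2 : EReal)} := by
    simp only [Set.mem_ofPred_eq, h₀, EReal.coe_le_coe_iff]
    linarith
  obtain ⟨ℓ, v, hv₁, hv₂⟩ := geometric_hahn_banach_point_closed hc hclosed hnot
  have hsplit : ∀ x t, ℓ (x, t) = ℓ (x, 0) + t * ℓ (0, 1) := by
    intro x t
    have : ((x, t) : E × ℝ) = (x, 0) + t • (0, 1) := by simp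
    rw [this, map_add, map_smul, smul_eq_mul]
  set κ := ℓ (0, 1) with hκ
  have hκpos : 0 < κ := by
    have h1 := hv₂ (x₀, r₀) (by simp [h₀])
    rw [hsplit] at h1 hv₁
    nlinarith
  let g : E →L[ℝ] ℝ := ℓ ∘L ContinuousLinearMap.inl ℝ E ℝ
  let d : E := (InnerProductSpace.toDual ℝ E).symm g
  have hd : ∀ x, ⟪d, x⟫_ℝ = ℓ (x, 0) := fun x => by
    simp [d, g]
  refine ⟨-(κ⁻¹ • d), -(κ⁻¹ * v), fun x => ?_⟩
  have key : ∀ t : ℝ, f x ≤ t → -(κ⁻¹ * ℓ (x, 0)) + κ⁻¹ * v ≤ t := by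
    intro t ht
    have h1 := hv₂ (x, t) ht
    rw [hsplit] at h1
    have h2 : κ⁻¹ * v ≤ κ⁻¹ * (ℓ (x, 0) + t * κ) :=
      mul_le_mul_of_nonneg_left h1.le (inv_nonneg.mpr hκpos.le)
    have h3 : κ⁻¹ * (ℓ (x, 0) + t * κ) = κ⁻¹ * ℓ (x, 0) + t := by field_simp
    linarith
  have hxe : ⟪x, -(κ⁻¹ • d)⟫_ℝ - -(κ⁻¹ * v) = -(κ⁻¹ * ℓ (x, 0)) + κ⁻¹ * v := by
    rw [inner_neg_right, inner_smul_right, real_inner_comm, hd]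
    ring
  rw [hxe]
  have hbot := hf.1 x
  generalize f x = c at key hbot ⊢
  induction c with
  | bot => exact absurd rfl hbot
  | top => exact le_top
  | coe c => exact EReal.coe_le_coe_iff.mpr (key c le_rfl)

theorem properFun_conjFun [CompleteSpace E] {f : E → EReal} (hf : ProperFun f)
    (hl : LowerSemicontinuous f) (hc : ConvexFun f) : ProperFun (conjFun f) := by
  refine ⟨conjFun_ne_bot hf, ?_⟩
  obtain ⟨s, r, h⟩ := exists_affine_minorant hf hl hc
  refine ⟨s, fun htop => ?_⟩
  have := conjFun_le_coe_iff.mpr h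
  rw [htop] at this
  exact EReal.coe_ne_top r (top_le_iff.mp this)

/-- Fermat's rule for `g + q` with `g` convex and `q` quadratic along lines through the minimizer
`p`, with gradient `a` there. -/
theorem neg_mem_subdiff_of_isMinOn {g : E → EReal} (hb : ∀ x, g x ≠ ⊥) (hc : ConvexFun g)
    {q b : E → ℝ} {p a : E}
    (hq : ∀ (d : E) (t : ℝ), q (p + t • d) = q p + t * ⟪a, d⟫_ℝ + t ^ 2 * b d)
    (hp : IsMinOn (fun z => g z + (q z : EReal)) Set.univ p) : -a ∈ subdiff g p := by
  intro y
  have hmin : ∀ z, g p + (q p : EReal) ≤ g z + (q z : EReal) := fun z => hp (Set.mem_univ z)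
  have hbp := hb p
  have hby := hb y
  induction hgp : g p with
  | bot => exact absurd hgp hbp
  | top =>
    have h := hmin y
    rw [hgp, EReal.top_add_coe, top_le_iff] at h
    induction hgy : g y with
    | bot => exact absurd hgy hby
    | top => exact le_top
    | coe s =>
      rw [hgy, ← EReal.coe_add] at h
      exact absurd h (EReal.coe_ne_top _)
  | coe r =>
    induction hgy : g y with
    | bot => exact absurd hgy hby
    | top => exact le_top
    | coe s =>
      have hline : ∀ t : ℝ, 0 ≤ t → t ≤ 1 →
          0 ≤ t * (s - r + ⟪a, y - p⟫_ℝ) + t ^ 2 * b (y - p) := by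
        intro t h0 h1
        have hcv := hc (x := (p, r)) (by simp [hgp]) (y := (y, s)) (by simp [hgy])
          (sub_nonneg.mpr h1) h0 (by ring)
        have hpt : (1 - t) • p + t • y = p + t • (y - p) := by module
        simp only [Set.mem_ofPred_eq, Prod.fst_add, Prod.snd_add, Prod.smul_fst, Prod.smul_snd,
          smul_eq_mul, hpt] at hcv
        have h2 := (hmin (p + t • (y - p))).trans (add_le_add_left hcv _)
        rw [hgp, hq] at h2
        norm_cast at h2
        linarith
      have hlim : 0 ≤ s - r + ⟪a, y - p⟫_ℝ := by
        by_contra hneg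
        push Not at hneg
        set X := s - r + ⟪a, y - p⟫_ℝ with hX
        set B := |b (y - p)| + 1 with hB
        have hBpos : 0 < B := by positivity
        have hbB : b (y - p) < B := lt_of_le_of_lt (le_abs_self _) (by linarith)
        -- At this step length the quadratic term is smaller than the linear one.
        set t := min 1 (-X / B) with ht
        have htpos : 0 < t := lt_min one_pos (div_pos (by linarith) hBpos)
        have h1 := hline t htpos.le (min_le_left _ _)
        have h2 : t * B ≤ -X := (le_div_iff₀ hBpos).mp (min_le_right _ _)
        have h3 : t * b (y - p) < t * B := mul_lt_mul_of_pos_left hbB htpos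
        nlinarith
      rw [inner_neg_left]
      norm_cast
      linarith

theorem proxObj_line (x p d : E) (t : ℝ) :
    1 / 2 * ‖p + t • d - x‖ ^ 2
      = 1 / 2 * ‖p - x‖ ^ 2 + t * ⟪p - x, d⟫_ℝ + t ^ 2 * (1 / 2 * ‖d‖ ^ 2) := by
  rw [show p + t • d - x = (p - x) + t • d by abel, norm_add_sq_real, inner_smul_right,
    norm_smul, mul_pow, Real.norm_eq_abs, sq_abs]
  ring

theorem exists_isMinOn_proxObj [FiniteDimensional ℝ E] {f : E → EReal} (hf : ProperFun f)
    (hl : LowerSemicontinuous f) (hc : ConvexFun f) (x : E) :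
    ∃ p, IsMinOn (fun z => f z + ((1 / 2 * ‖z - x‖ ^ 2 : ℝ) : EReal)) Set.univ p := by
  have : CompleteSpace E := FiniteDimensional.complete ℝ E
  have : ProperSpace E := FiniteDimensional.proper ℝ E
  obtain ⟨s, r, h⟩ := exists_affine_minorant hf hl hc
  obtain ⟨x₀, r₀, h₀⟩ := hf.exists_coe
  set F : E → EReal := fun z => f z + ((1 / 2 * ‖z - x‖ ^ 2 : ℝ) : EReal) with hF
  set C : ℝ := r₀ + 1 / 2 * ‖x₀ - x‖ ^ 2 with hC
  have hF₀ : F x₀ = C := by simp only [hF, h₀, hC]; norm_cast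
  set D : ℝ := 2 * (C + r - ⟪x, s⟫_ℝ) + ‖s‖ ^ 2 with hD
  -- The affine minorant confines the sublevel set of `x₀` to a ball about `x - s`.
  have hball : ∀ z, F z ≤ C → z ∈ Metric.closedBall (x - s) √D := by
    intro z hz
    have h1 : ((⟪z, s⟫_ℝ - r + 1 / 2 * ‖z - x‖ ^ 2 : ℝ) : EReal) ≤ C := by
      rw [EReal.coe_add]
      exact (add_le_add_left (h z) _).trans hz
    rw [EReal.coe_le_coe_iff] at h1
    rw [mem_closedBall_iff_norm]
    apply Real.le_sqrt_of_sq_le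
    rw [show z - (x - s) = (z - x) + s by abel, norm_add_sq_real, inner_sub_left]
    linarith
  have hFl : LowerSemicontinuous F := by
    refine hl.add' (Continuous.lowerSemicontinuous ?_) fun z => ?_
    · exact continuous_coe_real_ereal.comp (by fun_prop)
    · exact EReal.continuousAt_add (.inr (EReal.coe_ne_bot _)) (.inr (EReal.coe_ne_top _))
  obtain ⟨p, -, hp⟩ := LowerSemicontinuousOn.exists_isMinOn ⟨x₀, hball x₀ hF₀.le⟩
    (isCompact_closedBall (x - s) √D) (hFl.lowerSemicontinuousOn _)
  refine ⟨p, fun z _ => ?_⟩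
  by_cases hz : F z ≤ C
  · exact hp (hball z hz)
  · exact (hp (hball x₀ hF₀.le)).trans (hF₀.le.trans (not_le.mp hz).le)

theorem mem_subdiff_conjFun {f : E → EReal} (hf : ProperFun f) {s t : E}
    (h : t ∈ subdiff f s) : s ∈ subdiff (conjFun f) t := by
  obtain ⟨r, hr⟩ := hf.exists_coe_of_mem_subdiff h
  intro t'
  have h1 : conjFun f t ≤ ((⟪s, t⟫_ℝ - r : ℝ) : EReal) := by
    refine conjFun_le_coe_iff.mpr fun x => le_trans (le_of_eq ?_) (h x)
    rw [hr, ← EReal.coe_add, inner_sub_right, real_inner_comm t x, real_inner_comm t s]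
    congr 1
    ring
  have h2 : ((⟪s, t'⟫_ℝ - r : ℝ) : EReal) ≤ conjFun f t' := by
    rw [EReal.coe_sub, ← hr]
    exact le_iSup (fun x : E => ((⟪x, t'⟫_ℝ : ℝ) : EReal) - f x) s
  refine (add_le_add_left h1 _).trans (le_trans (le_of_eq ?_) h2)
  rw [← EReal.coe_add, inner_sub_right]
  congr 1
  ring

/-- The inversion rule `(∂f*)⁻¹ ⊆ ∂f` for a proper closed convex `f`. If `x ∈ ∂f*(t)`, the proximal
point `p` of `x + t` satisfies `x + t - p ∈ ∂f(p)`, hence `p ∈ ∂f*(x + t - p)`, and monotonicity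
of `∂f*` gives `-‖x - p‖² ≥ 0`. -/
theorem mem_subdiff_of_mem_subdiff_conjFun [FiniteDimensional ℝ E] {f : E → EReal}
    (hf : ProperFun f) (hl : LowerSemicontinuous f) (hc : ConvexFun f) {x t : E}
    (h : x ∈ subdiff (conjFun f) t) : t ∈ subdiff f x := by
  have : CompleteSpace E := FiniteDimensional.complete ℝ E
  obtain ⟨p, hp⟩ := exists_isMinOn_proxObj hf hl hc (x + t)
  have h1 : -(p - (x + t)) ∈ subdiff f p :=
    neg_mem_subdiff_of_isMinOn hf.1 hc (q := fun z => 1 / 2 * ‖z - (x + t)‖ ^ 2)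
      (fun d τ => proxObj_line (x + t) p d τ) hp
  have h2 := (properFun_conjFun hf hl hc).subdiff_monotone h (mem_subdiff_conjFun hf h1)
  rw [show t - -(p - (x + t)) = -(x - p) by abel, inner_neg_right,
    real_inner_self_eq_norm_sq] at h2
  have h3 : x - p = 0 := norm_eq_zero.mp (by nlinarith [norm_nonneg (x - p)])
  rw [sub_eq_zero] at h3
  subst h3
  simpa using h1

/-- The resolvent identity for the proximal mapping. -/
theorem prox_add_of_mem_subdiff {f : E → EReal} (hf : ProperFun f) {s t : E}
    (h : t ∈ subdiff f s) : prox f (s + t) = s := by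
  obtain ⟨r, hr⟩ := hf.exists_coe_of_mem_subdiff h
  have key : ∀ z, ((r + 1 / 2 * ‖s - (s + t)‖ ^ 2 + 1 / 2 * ‖z - s‖ ^ 2 : ℝ) : EReal)
      ≤ f z + ((1 / 2 * ‖z - (s + t)‖ ^ 2 : ℝ) : EReal) := by
    intro z
    refine le_trans (le_of_eq ?_) (add_le_add_left (h z) _)
    rw [hr, ← EReal.coe_add, ← EReal.coe_add, show z - (s + t) = (z - s) - t by abel,
      show s - (s + t) = -t by abel, norm_neg, norm_sub_sq_real (z - s), real_inner_comm (z - s) t]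
    congr 1
    ring
  have hmin : IsMinOn (fun z => f z + ((1 / 2 * ‖z - (s + t)‖ ^ 2 : ℝ) : EReal)) Set.univ s := by
    intro z _
    refine le_trans ?_ (key z)
    simp only [hr]
    rw [← EReal.coe_add, EReal.coe_le_coe_iff]
    nlinarith [sq_nonneg ‖z - s‖]
  have hspec : IsMinOn (fun z => f z + ((1 / 2 * ‖z - (s + t)‖ ^ 2 : ℝ) : EReal)) Set.univ
      (prox f (s + t)) := Classical.epsilon_spec
    (p := fun p => IsMinOn (fun z => f z + ((1 / 2 * ‖z - (s + t)‖ ^ 2 : ℝ) : EReal)) Set.univ p)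
    ⟨s, hmin⟩
  have h1 := (key (prox f (s + t))).trans (hspec (Set.mem_univ s))
  simp only [hr] at h1
  rw [← EReal.coe_add, EReal.coe_le_coe_iff] at h1
  have h2 : ‖prox f (s + t) - s‖ ^ 2 ≤ 0 := by linarith
  exact sub_eq_zero.mp (norm_eq_zero.mp (by nlinarith [norm_nonneg (prox f (s + t) - s)]))

/-! ### Normal vectors and projections -/

theorem convexFun_indicatorFun {C : Set E} (hC : Convex ℝ C) : ConvexFun (indicatorFun C) := by
  have : {p : E × ℝ | indicatorFun C p.1 ≤ (p.2 : EReal)} = C ×ˢ Set.Ici 0 := by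
    ext p
    simp [indicatorFun_le_coe_iff]
  rw [ConvexFun, this]
  exact hC.prod (convex_Ici 0)

/-- The subgradients of an indicator function are the normal vectors. -/
theorem mem_and_inner_le_of_mem_subdiff_indicatorFun {C : Set E} (hC : C.Nonempty) {x s : E}
    (h : s ∈ subdiff (indicatorFun C) x) : x ∈ C ∧ ∀ y ∈ C, ⟪s, y - x⟫_ℝ ≤ 0 := by
  have hx : x ∈ C := by
    obtain ⟨r, hr⟩ := (properFun_indicatorFun hC).exists_coe_of_mem_subdiff h
    exact (indicatorFun_le_coe_iff.mp hr.le).1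
  refine ⟨hx, fun y hy => ?_⟩
  have := coe_le_of_mem_subdiff h (a := 0) (b := 0) (indicatorFun_of_mem hx)
    (indicatorFun_of_mem hy)
  linarith

theorem projSet_eq_of_inner_le {C : Set E} {x p : E} (hp : p ∈ C)
    (h : ∀ y ∈ C, ⟪x - p, y - p⟫_ℝ ≤ 0) : projSet C x = p := by
  have key : ∀ y ∈ C, ‖x - p‖ ^ 2 + ‖y - p‖ ^ 2 ≤ ‖x - y‖ ^ 2 := by
    intro y hy
    rw [show x - y = (x - p) - (y - p) by abel, norm_sub_sq_real (x - p)]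
    linarith [h y hy]
  have hmin : p ∈ C ∧ IsMinOn (fun z => ‖x - z‖) C p := by
    refine ⟨hp, fun y hy => ?_⟩
    exact le_of_sq_le_sq (by nlinarith [key y hy, sq_nonneg ‖y - p‖]) (norm_nonneg _)
  obtain ⟨h1, h2⟩ := Classical.epsilon_spec
    (p := fun p => p ∈ C ∧ IsMinOn (fun z => ‖x - z‖) C p) ⟨p, hmin⟩
  change projSet C x ∈ C at h1
  have h3 : ‖x - projSet C x‖ ≤ ‖x - p‖ := h2 hp
  have h4 := key _ h1
  have h5 := pow_le_pow_left₀ (norm_nonneg _) h3 2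
  exact sub_eq_zero.mp (norm_eq_zero.mp (by nlinarith [norm_nonneg (projSet C x - p)]))

theorem projSet_spec [CompleteSpace E] {C : Set E} (hne : C.Nonempty) (hC : IsClosed C)
    (hcv : Convex ℝ C) (x : E) :
    projSet C x ∈ C ∧ ∀ y ∈ C, ⟪x - projSet C x, y - projSet C x⟫_ℝ ≤ 0 := by
  obtain ⟨p, hp, hp'⟩ := exists_norm_eq_iInf_of_complete_convex hne hC.isComplete hcv x
  have h := (norm_eq_iInf_iff_real_inner_le_zero hcv hp).mp hp'
  rw [projSet_eq_of_inner_le hp h]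
  exact ⟨hp, h⟩

/-- Nonexpansiveness of `I - Π_C`. -/
theorem norm_sub_projSet_sub_le [CompleteSpace E] {C : Set E} (hne : C.Nonempty) (hC : IsClosed C)
    (hcv : Convex ℝ C) (x y : E) :
    ‖(x - projSet C x) - (y - projSet C y)‖ ≤ ‖x - y‖ := by
  obtain ⟨hx, hx'⟩ := projSet_spec hne hC hcv x
  obtain ⟨hy, hy'⟩ := projSet_spec hne hC hcv y
  have h1 := hx' _ hy
  have h2 := hy' _ hx
  set p := projSet C x
  set q := projSet C y
  set a := (x - p) - (y - q) with ha
  have h3 : 0 ≤ ⟪a, p - q⟫_ℝ := by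
    rw [ha, inner_sub_left]
    rw [show q - p = -(p - q) by abel, inner_neg_right] at h1
    linarith
  have h4 : ‖a‖ ^ 2 ≤ ‖a‖ * ‖x - y‖ := by
    refine le_trans ?_ (real_inner_le_norm a (x - y))
    rw [show x - y = a + (p - q) by rw [ha]; abel, inner_add_right, real_inner_self_eq_norm_sq]
    linarith
  by_contra hlt
  push Not at hlt
  nlinarith [norm_nonneg (x - y)]

end ConvexAnalysis

/-! ### The Halpern iteration of a firmly nonexpansive map -/

section Halpern

variable {E : Type*} [NormedAddCommGroup E] [InnerProductSpace ℝ E]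

/-- The telescoping step of the Halpern estimate: with `g = a - b`, the potential
`k (k + 1) ‖g k‖² + (k + 1) ⟪g k, a k - a 0⟫` does not increase along the iteration. -/
theorem halpern_potential_step {κ : ℝ} (hκ : 0 ≤ κ) {a₀ a b a' b' : E}
    (hstep : (κ + 2) • a' = a₀ + (κ + 1) • ((2 : ℝ) • b - a))
    (hmono : 0 ≤ ⟪(a' - b') - (a - b), b' - b⟫_ℝ) :
    (κ + 1) * (κ + 2) * ‖a' - b'‖ ^ 2 + (κ + 2) * ⟪a' - b', a' - a₀⟫_ℝ
      ≤ κ * (κ + 1) * ‖a - b‖ ^ 2 + (κ + 1) * ⟪a - b, a - a₀⟫_ℝ := by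
  set g := a - b with hg
  set g' := a' - b' with hg'
  set D := a - a₀ with hD
  set D' := a' - a₀ with hD'
  have hb : b' - b = (D' - D) - (g' - g) := by simp only [hg, hg', hD, hD']; abel
  have hrel : (κ + 2) • D' = (κ + 1) • (D - (2 : ℝ) • g) := by
    have hb2 : (2 : ℝ) • b - a = D - (2 : ℝ) • g + a₀ := by simp only [hg, hD]; module
    rw [hb2] at hstep
    rw [hD', smul_sub, hstep]
    module
  have h1 : (κ + 2) * ⟪g, D'⟫_ℝ = (κ + 1) * (⟪g, D⟫_ℝ - 2 * ‖g‖ ^ 2) := by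
    have := congrArg (fun v => ⟪g, v⟫_ℝ) hrel
    simpa only [inner_smul_right, inner_sub_right, real_inner_self_eq_norm_sq] using this
  have h2 : (κ + 2) * ⟪g', D'⟫_ℝ = (κ + 1) * (⟪g', D⟫_ℝ - 2 * ⟪g', g⟫_ℝ) := by
    have := congrArg (fun v => ⟪g', v⟫_ℝ) hrel
    simpa only [inner_smul_right, inner_sub_right] using this
  have h3 : ⟪g' - g, b' - b⟫_ℝ = ⟪g', D'⟫_ℝ - ⟪g', D⟫_ℝ - ⟪g, D'⟫_ℝ + ⟪g, D⟫_ℝ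
      - ‖g'‖ ^ 2 + 2 * ⟪g', g⟫_ℝ - ‖g‖ ^ 2 := by
    rw [hb]
    simp only [inner_sub_left, inner_sub_right, real_inner_self_eq_norm_sq, real_inner_comm g g']
    ring
  rw [h3] at hmono
  have h4 := mul_nonneg (mul_nonneg (by linarith : 0 ≤ κ + 1) (by linarith : 0 ≤ κ + 2)) hmono
  linear_combination h4 - (κ + 1) * h1 + (κ + 2) * h2

/-- The Halpern iteration `a (k+1) = a 0 / (k+2) + (k+1)/(k+2) (2 b k - a k)`, where `b k` is the
resolvent of a monotone operator at `a k`, has `‖a k - b k‖ ≤ ‖a 0 - p‖ / (k + 1)` for every zero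
`p` of the operator, and its resolvent steps stay in the ball of radius `‖a 0 - p‖` about `p`. -/
theorem halpern_bounds {a b : ℕ → E} {p : E}
    (hstep : ∀ k : ℕ, a (k + 1) = (1 / ((k : ℝ) + 2)) • a 0
      + (((k : ℝ) + 1) / ((k : ℝ) + 2)) • ((2 : ℝ) • b k - a k))
    (hmono : ∀ i j, 0 ≤ ⟪(a i - b i) - (a j - b j), b i - b j⟫_ℝ)
    (hp : ∀ i, 0 ≤ ⟪a i - b i, b i - p⟫_ℝ) (k : ℕ) :
    ‖a k - b k‖ ≤ ‖a 0 - p‖ / ((k : ℝ) + 1) ∧ ‖b k - p‖ ≤ ‖a 0 - p‖ := by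
  have hsq : ∀ i, ‖a i - p‖ ^ 2 = ‖a i - b i‖ ^ 2 + 2 * ⟪a i - b i, b i - p⟫_ℝ
      + ‖b i - p‖ ^ 2 := by
    intro i
    rw [← norm_add_sq_real, sub_add_sub_cancel]
  have hpot : ∀ i : ℕ, (i : ℝ) * ((i : ℝ) + 1) * ‖a i - b i‖ ^ 2
      + ((i : ℝ) + 1) * ⟪a i - b i, a i - a 0⟫_ℝ ≤ 0 := by
    intro i
    induction i with
    | zero => simp
    | succ i ih =>
      have hi : (0 : ℝ) ≤ i := i.cast_nonneg
      refine le_trans ?_ ih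
      have hs : ((i : ℝ) + 2) • a (i + 1) = a 0 + ((i : ℝ) + 1) • ((2 : ℝ) • b i - a i) := by
        have hne : (i : ℝ) + 2 ≠ 0 := by positivity
        rw [hstep i, smul_add, smul_smul, smul_smul, mul_one_div_cancel hne, one_smul,
          mul_div_cancel₀ _ hne]
      have := halpern_potential_step hi hs (hmono (i + 1) i)
      push_cast
      linarith
  have hbdd : ∀ i : ℕ, ‖a i - p‖ ≤ ‖a 0 - p‖ := by
    intro i
    induction i with
    | zero => exact le_rfl
    | succ i ih =>
      have hi : (0 : ℝ) ≤ i := i.cast_nonneg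
      have hrefl : ‖(2 : ℝ) • b i - a i - p‖ ≤ ‖a i - p‖ := by
        refine le_of_sq_le_sq ?_ (norm_nonneg _)
        rw [show (2 : ℝ) • b i - a i - p = (b i - p) - (a i - b i) by module,
          norm_sub_sq_real (b i - p), hsq i, real_inner_comm]
        linarith [hp i]
      have hsplit : a (i + 1) - p = (1 / ((i : ℝ) + 2)) • (a 0 - p)
          + (((i : ℝ) + 1) / ((i : ℝ) + 2)) • ((2 : ℝ) • b i - a i - p) := by
        have hsum : 1 / ((i : ℝ) + 2) + ((i : ℝ) + 1) / ((i : ℝ) + 2) = 1 := by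
          field_simp
          ring
        rw [hstep i, eq_sub_of_add_eq' hsum]
        module
      rw [hsplit]
      refine (norm_add_le _ _).trans ?_
      rw [norm_smul, norm_smul, Real.norm_of_nonneg (by positivity),
        Real.norm_of_nonneg (by positivity)]
      calc _ ≤ 1 / ((i : ℝ) + 2) * ‖a 0 - p‖ + ((i : ℝ) + 1) / ((i : ℝ) + 2) * ‖a 0 - p‖ := by
            gcongr
            exact hrefl.trans ih
        _ = ‖a 0 - p‖ := by field_simp; ring
  constructor
  · have hk : (0 : ℝ) < (k : ℝ) + 1 := by positivity
    have h1 : (k : ℝ) * ‖a k - b k‖ ^ 2 + ⟪a k - b k, a k - a 0⟫_ℝ ≤ 0 := by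
      by_contra hlt
      push Not at hlt
      have := mul_pos hk hlt
      linarith [hpot k]
    have h2 : ((k : ℝ) + 1) * ‖a k - b k‖ ^ 2 ≤ ‖a k - b k‖ * ‖a 0 - p‖ := by
      refine le_trans ?_ (real_inner_le_norm (a k - b k) (a 0 - p))
      have h3 := hp k
      rw [show b k - p = (a k - a 0) - (a k - b k) + (a 0 - p) by abel, inner_add_right,
        inner_sub_right, real_inner_self_eq_norm_sq] at h3
      linarith
    rw [le_div_iff₀ hk]
    by_contra hlt
    push Not at hlt
    have h0 : 0 < ‖a k - b k‖ := by
      rcases (norm_nonneg (a k - b k)).eq_or_lt with h | h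
      · rw [← h, zero_mul] at hlt
        exact absurd hlt (not_lt.mpr (norm_nonneg _))
      · exact h
    nlinarith [mul_lt_mul_of_pos_left hlt h0]
  · refine le_trans (le_of_sq_le_sq ?_ (norm_nonneg _)) (hbdd k)
    rw [hsq k]
    nlinarith [hp k, sq_nonneg ‖a k - b k‖]

end Halpern

/-! ### Positive operators and their square roots -/

section Operators

variable {E : Type*} [NormedAddCommGroup E] [InnerProductSpace ℝ E] [FiniteDimensional ℝ E]

theorem opSqrt_apply_apply {T : E →L[ℝ] E} (hT : T.IsPositive) (x : E) :
    opSqrt T (opSqrt T x) = T x :=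
  congrArg (fun R : E →L[ℝ] E => R x) (opSqrt_spec T hT).2

theorem inner_opSqrt_opSqrt {T : E →L[ℝ] E} (hT : T.IsPositive) (x y : E) :
    ⟪opSqrt T x, opSqrt T y⟫_ℝ = ⟪T x, y⟫_ℝ := by
  rw [← (opSqrt_spec T hT).1.inner_left_eq_inner_right, opSqrt_apply_apply hT]

theorem opSeminorm_eq_norm_opSqrt {T : E →L[ℝ] E} (hT : T.IsPositive) (x : E) :
    opSeminorm T x = ‖opSqrt T x‖ := by
  rw [opSeminorm, real_inner_comm, ← inner_opSqrt_opSqrt hT, real_inner_self_eq_norm_sq,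
    Real.sqrt_sq (norm_nonneg _)]

theorem opSeminorm_sq {T : E →L[ℝ] E} (hT : T.IsPositive) (x : E) :
    opSeminorm T x ^ 2 = ⟪T x, x⟫_ℝ := by
  rw [opSeminorm_eq_norm_opSqrt hT, ← real_inner_self_eq_norm_sq, inner_opSqrt_opSqrt hT]

theorem abs_inner_le_opSeminorm_mul {T : E →L[ℝ] E} (hT : T.IsPositive) (x y : E) :
    |⟪T x, y⟫_ℝ| ≤ opSeminorm T x * opSeminorm T y := by
  rw [← inner_opSqrt_opSqrt hT, opSeminorm_eq_norm_opSqrt hT, opSeminorm_eq_norm_opSqrt hT]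
  exact abs_real_inner_le_norm _ _

theorem norm_apply_le_norm_opSqrt_mul {T : E →L[ℝ] E} (hT : T.IsPositive) (x : E) :
    ‖T x‖ ≤ ‖opSqrt T‖ * opSeminorm T x := by
  rw [opSeminorm_eq_norm_opSqrt hT, ← opSqrt_apply_apply hT]
  exact (opSqrt T).le_opNorm _

/-- If `T` is positive with eigenvalues at most `μ`, then `T (μ - T)` is positive semidefinite,
as its eigenvalues are `t (μ - t)` for the eigenvalues `t` of `T`. -/
theorem inner_apply_smul_sub_nonneg {T : E →L[ℝ] E} (hT : T.IsPositive) {μ : ℝ}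
    (hμ : ∀ t : ℝ, Module.End.HasEigenvalue (T : E →ₗ[ℝ] E) t → t ≤ μ) (x : E) :
    0 ≤ ⟪T x, μ • x - T x⟫_ℝ := by
  have hs := hT.isSymmetric
  let e := hs.eigenvectorBasis rfl
  let ev := hs.eigenvalues rfl
  have he : ∀ i, ⟪e i, T x⟫_ℝ = ev i * ⟪e i, x⟫_ℝ := by
    intro i
    have h1 : T (e i) = ev i • e i := hs.apply_eigenvectorBasis rfl i
    rw [← hT.inner_left_eq_inner_right, h1, real_inner_smul_left]
  rw [← e.sum_inner_mul_inner]
  refine Finset.sum_nonneg fun i _ => ?_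
  rw [real_inner_comm, inner_sub_right, inner_smul_right, he]
  have h0 : 0 ≤ ev i := hT.toLinearMap.nonneg_eigenvalues rfl i
  have h1 : ev i ≤ μ := hμ _ (hs.hasEigenvalue_eigenvalues rfl i)
  have := mul_nonneg (mul_nonneg h0 (sub_nonneg.mpr h1)) (sq_nonneg ⟪e i, x⟫_ℝ)
  linarith

end Operators

variable {m n : ℕ}

/-! ### The operators of the metric -/

@[simp] theorem yOf_mkU (y : Vec m) (w z x : Vec n) : yOf (mkU y w z x) = y := rfl
@[simp] theorem zOf_mkU (y : Vec m) (w z x : Vec n) : zOf (mkU y w z x) = z := rfl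
@[simp] theorem xOf_mkU (y : Vec m) (w z x : Vec n) : xOf (mkU y w z x) = x := rfl
@[simp] theorem yOf_sub (u v : USp m n) : yOf (u - v) = yOf u - yOf v := rfl
@[simp] theorem wOf_sub (u v : USp m n) : wOf (u - v) = wOf u - wOf v := rfl
@[simp] theorem xOf_sub (u v : USp m n) : xOf (u - v) = xOf u - xOf v := rfl
@[simp] theorem xOf_zero : xOf (0 : USp m n) = 0 := rfl

theorem inner_USp (u v : USp m n) : ⟪u, v⟫_ℝ =
    ⟪yOf u, yOf v⟫_ℝ + ⟪wOf u, wOf v⟫_ℝ + (⟪zOf u, zOf v⟫_ℝ + ⟪xOf u, xOf v⟫_ℝ) := by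
  rw [WithLp.prod_inner_apply, WithLp.prod_inner_apply, WithLp.prod_inner_apply]
  rfl

theorem inner_USp_fst (u v : USp m n) : ⟪u, v⟫_ℝ =
    ⟪u.fst, v.fst⟫_ℝ + (⟪zOf u, zOf v⟫_ℝ + ⟪xOf u, xOf v⟫_ℝ) :=
  (WithLp.prod_inner_apply u v).trans
    (congrArg (⟪u.fst, v.fst⟫_ℝ + ·) (WithLp.prod_inner_apply _ _))

theorem norm_sq_fst_USp (u : USp m n) : ‖u.fst‖ ^ 2 = ‖yOf u‖ ^ 2 + ‖wOf u‖ ^ 2 :=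
  WithLp.prod_norm_sq_eq_of_L2 _

theorem norm_sq_USp (u : USp m n) :
    ‖u‖ ^ 2 = ‖u.fst‖ ^ 2 + (‖zOf u‖ ^ 2 + ‖xOf u‖ ^ 2) := by
  rw [WithLp.prod_norm_sq_eq_of_L2, WithLp.prod_norm_sq_eq_of_L2 u.snd]
  rfl

namespace CCQP

variable (P : CCQP m n)

theorem isPositive_blockDiag {B : Vec m →L[ℝ] Vec m} {C : Vec n →L[ℝ] Vec n}
    (hB : B.IsPositive) (hC : C.IsPositive) :
    (blockDiag B C : VSp m n →L[ℝ] VSp m n).IsPositive := by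
  have happ : ∀ v : VSp m n, blockDiag B C v = WithLp.toLp 2 (B v.fst, C v.snd) := fun _ => rfl
  refine ContinuousLinearMap.isPositive_iff _ |>.mpr ⟨fun v v' => ?_, fun v => ?_⟩
  · simp only [ContinuousLinearMap.coe_coe, happ, WithLp.prod_inner_apply]
    exact congrArg₂ (· + ·) (hB.inner_left_eq_inner_right _ _) (hC.inner_left_eq_inner_right _ _)
  · simp only [happ, WithLp.prod_inner_apply]
    exact add_nonneg (hB.inner_nonneg_left _) (hC.inner_nonneg_left _)

theorem inner_At_left (y : Vec m) (x : Vec n) : ⟪P.At y, x⟫_ℝ = ⟪y, P.A x⟫_ℝ :=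
  ContinuousLinearMap.adjoint_inner_left _ _ _

theorem inner_Q_left (x y : Vec n) : ⟪P.Q x, y⟫_ℝ = ⟪x, P.Q y⟫_ℝ :=
  P.Q_pos.inner_left_eq_inner_right x y

theorem AQ_apply (v : VSp m n) : P.AQ v = P.At v.fst - P.Q v.snd := rfl

theorem AQt_apply (x : Vec n) : P.AQt x = WithLp.toLp 2 (P.A x, -P.Q x) := by
  refine ext_inner_right ℝ fun v => ?_
  rw [AQt, ContinuousLinearMap.adjoint_inner_left, AQ_apply, WithLp.prod_inner_apply,
    inner_sub_right, real_inner_comm _ x, inner_At_left, real_inner_comm, ← inner_Q_left]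
  simp [sub_eq_add_neg]

theorem isPositive_Sw {lamQ : ℝ}
    (hlam : ∀ μ : ℝ, Module.End.HasEigenvalue (P.Q : Vec n →ₗ[ℝ] Vec n) μ → μ ≤ lamQ) :
    (P.Sw lamQ).IsPositive := by
  have happ : ∀ w, P.Sw lamQ w = P.Q (lamQ • w - P.Q w) := fun _ => rfl
  refine ContinuousLinearMap.isPositive_iff _ |>.mpr ⟨fun w w' => ?_, fun w => ?_⟩
  · simp only [ContinuousLinearMap.coe_coe, happ, map_sub, map_smul, inner_sub_left,
      inner_sub_right, inner_smul_left, inner_smul_right, inner_Q_left]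
    rfl
  · rw [happ, inner_Q_left, real_inner_comm]
    exact inner_apply_smul_sub_nonneg P.Q_pos hlam w

/-- On `W = Range Q` the operator `σ Q² + Q + σ S_w` is `(1 + σ λ_Q) Q`, so that its inverse
cancels against `Q`. -/
theorem SsGS1_eq {σ lamQ : ℝ} (hσ : 0 < σ) (hlam : 0 < lamQ) :
    P.SsGS1 σ lamQ = (σ ^ 2 / (1 + σ * lamQ)) • (P.A ∘L P.Q ∘L P.At) := by
  have hne : 1 + σ * lamQ ≠ 0 := by positivity
  have hinv : ∀ v : Vec n, P.Q ((Ring.inverse (P.wBlockW σ lamQ) (P.QtoW v) : P.W) : Vec n)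
      = (1 + σ * lamQ)⁻¹ • P.Q v := by
    intro v
    have h1 : P.wBlockW σ lamQ (Ring.inverse (P.wBlockW σ lamQ) (P.QtoW v)) = P.QtoW v :=
      congrArg (fun f : Module.End ℝ P.W => f (P.QtoW v))
        (Ring.mul_inverse_cancel _ (P.isUnit_wBlockW hσ hlam))
    have h2 : P.wBlock σ lamQ ((Ring.inverse (P.wBlockW σ lamQ) (P.QtoW v) : P.W) : Vec n)
        = P.Q v := congrArg Subtype.val h1
    rw [wBlock_apply] at h2
    rw [← h2, smul_smul, inv_mul_cancel₀ hne, one_smul]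
  ext1 y
  change σ ^ 2 • P.A (P.Q ((Ring.inverse (P.wBlockW σ lamQ) (P.QtoW (P.At y)) : P.W) : Vec n))
    = (σ ^ 2 / (1 + σ * lamQ)) • P.A (P.Q (P.At y))
  rw [hinv, map_smul, smul_smul, div_eq_mul_inv]

theorem isPositive_T1 {σ lamQ : ℝ} (hσ : 0 < σ) (hlamQ : 0 < lamQ)
    (hlam : ∀ μ : ℝ, Module.End.HasEigenvalue (P.Q : Vec n →ₗ[ℝ] Vec n) μ → μ ≤ lamQ)
    {Sy : Vec m →L[ℝ] Vec m} (hSy : Sy.IsPositive) : (P.T1 σ lamQ Sy).IsPositive := by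
  refine ContinuousLinearMap.IsPositive.add ?_ ?_
  · exact (isPositive_blockDiag hSy (P.isPositive_Sw hlam)).smul_of_nonneg hσ.le
  · refine isPositive_blockDiag ?_ ContinuousLinearMap.isPositive_zero
    rw [P.SsGS1_eq hσ hlamQ]
    exact (P.Q_pos.conj_adjoint P.A).smul_of_nonneg (by positivity)

theorem yOf_T1 {σ lamQ : ℝ} (hσ : 0 < σ) (hlam : 0 < lamQ) (Sy : Vec m →L[ℝ] Vec m)
    (v : VSp m n) : (P.T1 σ lamQ Sy v).fst =
      σ • Sy v.fst + (σ ^ 2 / (1 + σ * lamQ)) • P.A (P.Q (P.At v.fst)) := by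
  change σ • Sy v.fst + P.SsGS1 σ lamQ v.fst = _
  rw [P.SsGS1_eq hσ hlam]
  rfl

theorem wOf_T1 (σ lamQ : ℝ) (Sy : Vec m →L[ℝ] Vec m) (v : VSp m n) :
    (P.T1 σ lamQ Sy v).snd = σ • P.Q (lamQ • v.snd - P.Q v.snd) := by
  change σ • P.Q (lamQ • v.snd - P.Q v.snd) + 0 = _
  rw [add_zero]

theorem fst_metric (σ lamQ : ℝ) (Sy : Vec m →L[ℝ] Vec m) (u : USp m n) :
    (P.metric σ lamQ Sy u).fst = P.AQt (σ • P.AQ u.fst + xOf u) + P.T1 σ lamQ Sy u.fst := by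
  change σ • P.AQt (P.AQ u.fst) + P.T1 σ lamQ Sy u.fst + P.AQt (xOf u) = _
  rw [map_add, map_smul]
  abel

theorem zOf_metric (σ lamQ : ℝ) (Sy : Vec m →L[ℝ] Vec m) (u : USp m n) :
    zOf (P.metric σ lamQ Sy u) = 0 := rfl

theorem xOf_metric (σ lamQ : ℝ) (Sy : Vec m →L[ℝ] Vec m) (u : USp m n) :
    xOf (P.metric σ lamQ Sy u) = P.AQ u.fst + σ⁻¹ • xOf u := rfl

theorem inner_metric {σ : ℝ} (hσ : 0 < σ) (lamQ : ℝ) (Sy : Vec m →L[ℝ] Vec m) (u v : USp m n) :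
    ⟪P.metric σ lamQ Sy u, v⟫_ℝ =
      σ⁻¹ * ⟪σ • P.AQ u.fst + xOf u, σ • P.AQ v.fst + xOf v⟫_ℝ
        + ⟪P.T1 σ lamQ Sy u.fst, v.fst⟫_ℝ := by
  have hx : xOf (P.metric σ lamQ Sy u) = σ⁻¹ • (σ • P.AQ u.fst + xOf u) := by
    rw [xOf_metric, smul_add, smul_smul, inv_mul_cancel₀ hσ.ne', one_smul]
  rw [inner_USp_fst, zOf_metric, hx, fst_metric, inner_zero_left, inner_add_left, AQt,
    ContinuousLinearMap.adjoint_inner_left, real_inner_smul_left, inner_add_right,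
    inner_smul_right]
  field_simp
  ring

theorem isPositive_metric {σ lamQ : ℝ} (hσ : 0 < σ) {Sy : Vec m →L[ℝ] Vec m}
    (hT : (P.T1 σ lamQ Sy).IsPositive) : (P.metric σ lamQ Sy).IsPositive := by
  refine ContinuousLinearMap.isPositive_iff _ |>.mpr ⟨fun u v => ?_, fun u => ?_⟩
  · simp only [ContinuousLinearMap.coe_coe]
    rw [real_inner_comm _ u, inner_metric P hσ, inner_metric P hσ, hT.inner_left_eq_inner_right,
      real_inner_comm (P.T1 σ lamQ Sy v.fst), real_inner_comm _ (σ • P.AQ u.fst + xOf u)]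
  · rw [inner_metric P hσ, real_inner_self_eq_norm_sq]
    exact add_nonneg (by positivity) (hT.inner_nonneg_left _)

theorem opSeminorm_metric_sq {σ lamQ : ℝ} (hσ : 0 < σ) {Sy : Vec m →L[ℝ] Vec m}
    (hT : (P.T1 σ lamQ Sy).IsPositive) (u : USp m n) :
    opSeminorm (P.metric σ lamQ Sy) u ^ 2 =
      σ⁻¹ * ‖σ • P.AQ u.fst + xOf u‖ ^ 2 + opSeminorm (P.T1 σ lamQ Sy) u.fst ^ 2 := by
  rw [opSeminorm_sq (P.isPositive_metric hσ hT), opSeminorm_sq hT, inner_metric P hσ,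
    real_inner_self_eq_norm_sq]

theorem norm_smul_AQ_add_le {σ lamQ : ℝ} (hσ : 0 < σ) {Sy : Vec m →L[ℝ] Vec m}
    (hT : (P.T1 σ lamQ Sy).IsPositive) (u : USp m n) :
    ‖σ • P.AQ u.fst + xOf u‖ ≤ √σ * opSeminorm (P.metric σ lamQ Sy) u := by
  refine le_of_sq_le_sq ?_ (mul_nonneg (Real.sqrt_nonneg _) (Real.sqrt_nonneg _))
  rw [mul_pow, Real.sq_sqrt hσ.le, P.opSeminorm_metric_sq hσ hT, mul_add, ← mul_assoc,
    mul_inv_cancel₀ hσ.ne', one_mul]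
  exact le_add_of_nonneg_right (by positivity)

theorem norm_xOf_metric_le {σ lamQ : ℝ} (hσ : 0 < σ) {Sy : Vec m →L[ℝ] Vec m}
    (hT : (P.T1 σ lamQ Sy).IsPositive) (u : USp m n) :
    ‖xOf (P.metric σ lamQ Sy u)‖ ≤ opSeminorm (P.metric σ lamQ Sy) u / √σ := by
  have hs : 0 < √σ := Real.sqrt_pos.mpr hσ
  have hx : xOf (P.metric σ lamQ Sy u) = σ⁻¹ • (σ • P.AQ u.fst + xOf u) := by
    rw [xOf_metric, smul_add, smul_smul, inv_mul_cancel₀ hσ.ne', one_smul]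
  rw [hx, norm_smul, Real.norm_of_nonneg (inv_nonneg.mpr hσ.le), le_div_iff₀ hs]
  calc σ⁻¹ * ‖σ • P.AQ u.fst + xOf u‖ * √σ
      ≤ σ⁻¹ * (√σ * opSeminorm (P.metric σ lamQ Sy) u) * √σ := by
        gcongr
        exact P.norm_smul_AQ_add_le hσ hT u
    _ = σ⁻¹ * (√σ * √σ) * opSeminorm (P.metric σ lamQ Sy) u := by ring
    _ = opSeminorm (P.metric σ lamQ Sy) u := by
        rw [Real.mul_self_sqrt hσ.le, inv_mul_cancel₀ hσ.ne', one_mul]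

theorem norm_fst_metric_le {σ lamQ : ℝ} (hσ : 0 < σ) {Sy : Vec m →L[ℝ] Vec m}
    (hT : (P.T1 σ lamQ Sy).IsPositive) (u : USp m n) :
    ‖(P.metric σ lamQ Sy u).fst‖ ≤ (‖P.AQt‖ * √σ + ‖opSqrt (P.T1 σ lamQ Sy)‖)
      * opSeminorm (P.metric σ lamQ Sy) u := by
  have hle : opSeminorm (P.T1 σ lamQ Sy) u.fst ≤ opSeminorm (P.metric σ lamQ Sy) u := by
    refine le_of_sq_le_sq ?_ (Real.sqrt_nonneg _)
    rw [P.opSeminorm_metric_sq hσ hT]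
    exact le_add_of_nonneg_left (by positivity)
  rw [fst_metric, add_mul, mul_assoc]
  refine (norm_add_le _ _).trans (add_le_add ?_ ?_)
  · exact (P.AQt.le_opNorm _).trans
      (mul_le_mul_of_nonneg_left (P.norm_smul_AQ_add_le hσ hT u) (norm_nonneg _))
  · exact (norm_apply_le_norm_opSqrt_mul hT _).trans
      (mul_le_mul_of_nonneg_left hle (norm_nonneg _))

/-! ### The perturbed KKT system -/

theorem isClosed_K : IsClosed P.K := by
  have : P.K = ⋂ i,
      {v : Vec m | P.lo i ≤ (v i : EReal)} ∩ {v : Vec m | (v i : EReal) ≤ P.hi i} := by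
    ext v
    simp [K]
  rw [this]
  refine isClosed_iInter fun i => ?_
  have hc : Continuous fun v : Vec m => ((v i : ℝ) : EReal) :=
    continuous_coe_real_ereal.comp (by fun_prop)
  exact (isClosed_le continuous_const hc).inter (isClosed_le hc continuous_const)

theorem convex_K : Convex ℝ P.K := by
  intro v hv v' hv' α β hα hβ hαβ i
  have hord : Set.OrdConnected {r : ℝ | P.lo i ≤ (r : EReal) ∧ (r : EReal) ≤ P.hi i} := by
    refine ⟨fun a ha b hb c hc => ⟨?_, ?_⟩⟩
    · exact ha.1.trans (EReal.coe_le_coe_iff.mpr hc.1)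
    · exact (EReal.coe_le_coe_iff.mpr hc.2).trans hb.2
  exact hord.convex (hv i) (hv' i) hα hβ hαβ

theorem nonempty_K : P.K.Nonempty := P.K_nonempty

theorem properFun_suppK : ProperFun P.suppK :=
  properFun_conjFun (properFun_indicatorFun P.nonempty_K)
    (lowerSemicontinuous_indicatorFun P.isClosed_K) (convexFun_indicatorFun P.convex_K)

theorem properFun_φc : ProperFun P.φc := properFun_conjFun P.φ_proper P.φ_closed P.φ_convex

/-- `-e ∈ T(u)` for the monotone KKT operator `T` of the restricted Wolfe dual, whose zeros solve
the KKT system: `u` solves that system up to the perturbation `e`. -/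
structure IsPerturbedKKT (u e : USp m n) : Prop where
  y_mem : P.A (xOf u) + yOf e ∈ subdiff P.suppK (-yOf u)
  w_eq : P.Q (wOf u) - P.Q (xOf u) + wOf e = 0
  z_mem : xOf u ∈ subdiff P.φc (-zOf u)
  z_eq : zOf e = 0
  x_eq : P.res (yOf u) (wOf u) (zOf u) = xOf e

variable {P}

theorem IsKKT.isPerturbedKKT {u : USp m n} (h : P.IsKKT u) : P.IsPerturbedKKT u 0 := by
  obtain ⟨-, hw, hy, hz, hx⟩ := h
  refine ⟨?_, ?_, hz, rfl, hx⟩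
  · change P.A (xOf u) + 0 ∈ _
    rwa [add_zero]
  · change P.Q (wOf u) - P.Q (xOf u) + 0 = 0
    rw [add_zero, hw]

theorem IsPerturbedKKT.exists_dualObj_eq {u e : USp m n} (h : P.IsPerturbedKKT u e) :
    ∃ r : ℝ, P.dualObj (yOf u) (wOf u) (zOf u) = r := by
  obtain ⟨a, ha⟩ := P.properFun_suppK.exists_coe_of_mem_subdiff h.y_mem
  obtain ⟨b, hb⟩ := P.properFun_φc.exists_coe_of_mem_subdiff h.z_mem
  refine ⟨1 / 2 * ⟪wOf u, P.Q (wOf u)⟫_ℝ + a + b, ?_⟩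
  rw [dualObj, ha, hb]
  norm_cast

/-- The subgradient inequalities at a perturbed KKT point, summed over the blocks. The constraint
residuals turn the multiplier terms into the last two inner products, which are antisymmetric in
the two points. -/
theorem IsPerturbedKKT.dualObj_le {u e u' e' : USp m n} (h : P.IsPerturbedKKT u e)
    (h' : P.IsPerturbedKKT u' e') {r r' : ℝ}
    (hr : P.dualObj (yOf u) (wOf u) (zOf u) = r) (hr' : P.dualObj (yOf u') (wOf u') (zOf u') = r') :
    r ≤ r' + ⟪e, u' - u⟫_ℝ + ⟪xOf u, xOf e'⟫_ℝ - ⟪xOf u', xOf e⟫_ℝ := by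
  obtain ⟨a, ha⟩ := P.properFun_suppK.exists_coe_of_mem_subdiff h.y_mem
  obtain ⟨b, hb⟩ := P.properFun_φc.exists_coe_of_mem_subdiff h.z_mem
  obtain ⟨a', ha'⟩ := P.properFun_suppK.exists_coe_of_mem_subdiff h'.y_mem
  obtain ⟨b', hb'⟩ := P.properFun_φc.exists_coe_of_mem_subdiff h'.z_mem
  rw [dualObj, ha, hb] at hr
  rw [dualObj, ha', hb'] at hr'
  norm_cast at hr hr'
  have hy := coe_le_of_mem_subdiff h.y_mem ha ha'
  have hz := coe_le_of_mem_subdiff h.z_mem hb hb'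
  have hw : 0 ≤ ⟪wOf u' - wOf u, P.Q (wOf u' - wOf u)⟫_ℝ := P.Q_pos.inner_nonneg_right _
  have hwe : P.Q (wOf u) = P.Q (xOf u) - wOf e := by
    rw [eq_sub_iff_add_eq, ← sub_eq_zero, ← h.w_eq]
    abel
  have hwe' : ⟪P.Q (wOf u), wOf u' - wOf u⟫_ℝ
      = ⟪xOf u, P.Q (wOf u') - P.Q (wOf u)⟫_ℝ - ⟪wOf e, wOf u' - wOf u⟫_ℝ := by
    rw [← map_sub, ← inner_Q_left, ← inner_sub_left, ← hwe]
  have hres : ⟪xOf u, xOf e'⟫_ℝ - ⟪xOf u, xOf e⟫_ℝ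
      = -⟪xOf u, P.Q (wOf u') - P.Q (wOf u)⟫_ℝ + ⟪P.A (xOf u), yOf u' - yOf u⟫_ℝ
        + ⟪xOf u, zOf u' - zOf u⟫_ℝ := by
    rw [real_inner_comm _ (P.A (xOf u)), ← inner_At_left, real_inner_comm (xOf u) (P.At _),
      ← inner_sub_right, ← inner_neg_right, ← inner_add_right, ← inner_add_right, ← h.x_eq,
      ← h'.x_eq, res, res,
      map_sub]
    congr 1
    abel
  have hQ : ⟪wOf u, P.Q (wOf u')⟫_ℝ = ⟪wOf u', P.Q (wOf u)⟫_ℝ := by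
    rw [← inner_Q_left, real_inner_comm]
  rw [inner_USp, h.z_eq]
  simp only [yOf_sub, wOf_sub, xOf_sub, inner_add_left, inner_sub_right, inner_neg_right,
    inner_zero_left, map_sub, inner_sub_left, real_inner_comm (xOf e)] at *
  have hc : ⟪P.Q (wOf u), wOf u'⟫_ℝ = ⟪wOf u', P.Q (wOf u)⟫_ℝ := real_inner_comm _ _
  have hc' : ⟪P.Q (wOf u), wOf u⟫_ℝ = ⟪wOf u, P.Q (wOf u)⟫_ℝ := real_inner_comm _ _
  linarith

/-- Monotonicity of the KKT operator. -/
theorem IsPerturbedKKT.inner_sub_nonpos {u e u' e' : USp m n} (h : P.IsPerturbedKKT u e)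
    (h' : P.IsPerturbedKKT u' e') : ⟪e - e', u - u'⟫_ℝ ≤ 0 := by
  obtain ⟨r, hr⟩ := h.exists_dualObj_eq
  obtain ⟨r', hr'⟩ := h'.exists_dualObj_eq
  have h1 := h.dualObj_le h' hr hr'
  have h2 := h'.dualObj_le h hr' hr
  simp only [inner_sub_left, inner_sub_right] at *
  linarith

/-- At a perturbed KKT point the `z`-block of the KKT residual vanishes, and the other blocks are
bounded by those of the perturbation. -/
theorem IsPerturbedKKT.norm_kktResidual_le {u e : USp m n} (h : P.IsPerturbedKKT u e) :
    ‖P.kktResidual u‖ ≤ ‖e.fst‖ + ‖xOf e‖ := by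
  have hK := mem_subdiff_of_mem_subdiff_conjFun (properFun_indicatorFun P.nonempty_K)
    (lowerSemicontinuous_indicatorFun P.isClosed_K) (convexFun_indicatorFun P.convex_K) h.y_mem
  obtain ⟨hs, hs'⟩ := mem_and_inner_le_of_mem_subdiff_indicatorFun P.nonempty_K hK
  set s := P.A (xOf u) + yOf e with hs_def
  have hproj : projSet P.K (s - yOf u) = s :=
    projSet_eq_of_inner_le hs fun v hv => by
      rw [show s - yOf u - s = -yOf u by abel]
      exact hs' v hv
  have hy : ‖yOf (P.kktResidual u)‖ ≤ ‖yOf e‖ := by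
    have hne := norm_sub_projSet_sub_le P.nonempty_K P.isClosed_K P.convex_K
      (P.A (xOf u) - yOf u) (s - yOf u)
    rw [hproj] at hne
    have h1 : P.A (xOf u) - yOf u - (s - yOf u) = -yOf e := by rw [hs_def]; abel
    have h2 : P.A (xOf u) - yOf u - projSet P.K (P.A (xOf u) - yOf u) - (s - yOf u - s)
        = yOf (P.kktResidual u) := by
      rw [kktResidual, yOf_mkU]
      abel
    rwa [h1, h2, norm_neg] at hne
  have hw : wOf (P.kktResidual u) = -wOf e := eq_neg_of_add_eq_zero_left h.w_eq
  have hz : zOf (P.kktResidual u) = 0 := by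
    have h1 := prox_add_of_mem_subdiff P.φ_proper
      (mem_subdiff_of_mem_subdiff_conjFun P.φ_proper P.φ_closed P.φ_convex h.z_mem)
    rw [← sub_eq_add_neg] at h1
    rw [kktResidual, zOf_mkU, h1, sub_self]
  have hx : xOf (P.kktResidual u) = -xOf e := by
    rw [← h.x_eq, kktResidual, xOf_mkU, res]
    abel
  refine le_of_sq_le_sq ?_ (by positivity)
  rw [norm_sq_USp, norm_sq_fst_USp, hw, hz, hx, norm_neg, norm_neg, norm_zero, add_sq,
    norm_sq_fst_USp e]
  have := pow_le_pow_left₀ (norm_nonneg _) hy 2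
  have := mul_nonneg (norm_nonneg e.fst) (norm_nonneg (xOf e))
  linarith

/-! ### One step of the method as a resolvent step -/

theorem IsHPRSeq.zOf_mem {σ lamQ : ℝ} {Sy : Vec m →L[ℝ] Vec m} {u ubar uhat : ℕ → USp m n}
    {whalf : ℕ → Vec n} (h : P.IsHPRSeq σ lamQ Sy u ubar uhat whalf) (k : ℕ) :
    xOf (ubar (k + 1)) ∈ subdiff P.φc (-zOf (ubar (k + 1))) := by
  apply mem_subdiff_neg_of_neg_mem
  refine neg_mem_subdiff_of_isMinOn (fun z => P.properFun_φc.1 _)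
    (convexFun_conjFun_neg P.φ) (b := fun d => σ / 2 * ‖d‖ ^ 2) (fun d t => ?_) (h.step1 k)
  rw [h.step2 k]
  have hres : P.res (yOf (u k)) (wOf (u k)) (zOf (ubar (k + 1)) + t • d)
      = P.res (yOf (u k)) (wOf (u k)) (zOf (ubar (k + 1))) + t • d := by
    simp only [res]
    abel
  rw [hres, norm_add_sq_real, norm_smul, mul_pow, Real.norm_eq_abs, sq_abs, ← res]
  simp only [inner_add_right, inner_add_left, inner_smul_right, real_inner_smul_left]
  ring

theorem IsHPRSeq.yOf_mem {σ lamQ : ℝ} {Sy : Vec m →L[ℝ] Vec m} (hSy : Sy.IsPositive)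
    {u ubar uhat : ℕ → USp m n} {whalf : ℕ → Vec n}
    (h : P.IsHPRSeq σ lamQ Sy u ubar uhat whalf) (k : ℕ) :
    P.A (xOf (ubar (k + 1))
        + σ • P.res (yOf (ubar (k + 1))) (whalf k) (zOf (ubar (k + 1))))
      + σ • Sy (yOf (ubar (k + 1)) - yOf (u k)) ∈ subdiff P.suppK (-yOf (ubar (k + 1))) := by
  apply mem_subdiff_neg_of_neg_mem
  have hmin := h.step3_2 k
  simp only [augLagY, add_assoc, ← EReal.coe_add] at hmin
  refine neg_mem_subdiff_of_isMinOn (fun z => P.properFun_suppK.1 _)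
    (convexFun_conjFun_neg _) (b := fun d => σ / 2 * ‖P.At d‖ ^ 2 + σ / 2 * ⟪Sy d, d⟫_ℝ)
    (fun d t => ?_) hmin
  have hres : P.res (yOf (ubar (k + 1)) + t • d) (whalf k) (zOf (ubar (k + 1)))
      = P.res (yOf (ubar (k + 1))) (whalf k) (zOf (ubar (k + 1))) + t • P.At d := by
    simp only [res, map_add, map_smul]
    abel
  have hsub : yOf (ubar (k + 1)) + t • d - yOf (u k)
      = (yOf (ubar (k + 1)) - yOf (u k)) + t • d := by abel
  set ρ := P.res (yOf (ubar (k + 1))) (whalf k) (zOf (ubar (k + 1)))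
  set δ := yOf (ubar (k + 1)) - yOf (u k)
  have hA : ∀ x, ⟪x, P.At d⟫_ℝ = ⟪P.A x, d⟫_ℝ := fun x => by
    rw [real_inner_comm, inner_At_left, real_inner_comm]
  have hS : ⟪Sy d, δ⟫_ℝ = ⟪Sy δ, d⟫_ℝ := by
    rw [hSy.inner_left_eq_inner_right, real_inner_comm]
  rw [hres, hsub, norm_add_sq_real, norm_smul, mul_pow, Real.norm_eq_abs, sq_abs,
    opSeminorm_sq hSy, opSeminorm_sq hSy]
  simp only [map_add, map_smul, inner_add_right, inner_add_left, inner_smul_right,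
    real_inner_smul_left, hA, hS]
  ring

/-- The point computed from `u k` is the resolvent, in the metric `M`, of the KKT operator at
`u k`. The two passes over `w` around the update of `y` (a symmetric Gauss–Seidel sweep) leave the
term `σ² / (1 + σ λ_Q) A Q A*` in the `y`-block, which is the one of `Ŝ_sGS`. -/
theorem IsHPRSeq.isPerturbedKKT {σ lamQ : ℝ} (hσ : 0 < σ) (hlamQ : 0 < lamQ)
    {Sy : Vec m →L[ℝ] Vec m} (hSy : Sy.IsPositive)
    {u ubar uhat : ℕ → USp m n} {whalf : ℕ → Vec n}
    (h : P.IsHPRSeq σ lamQ Sy u ubar uhat whalf) (k : ℕ) :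
    P.IsPerturbedKKT (ubar (k + 1)) (P.metric σ lamQ Sy (ubar (k + 1) - u k)) := by
  have hy := h.yOf_mem hSy k
  have hz := h.zOf_mem k
  have h2 := h.step2 k
  have h31 := h.step3_1 k
  have h33 := h.step3_3 k
  have hc : 1 + σ * lamQ ≠ 0 := by positivity
  set y := yOf (u k) with y_def
  set w := wOf (u k) with w_def
  set x := xOf (u k) with x_def
  set y' := yOf (ubar (k + 1)) with y'_def
  set w' := wOf (ubar (k + 1)) with w'_def
  set z' := zOf (ubar (k + 1)) with z'_def
  set x' := xOf (ubar (k + 1)) with x'_def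
  have hAQ : P.AQ (ubar (k + 1) - u k).fst = P.At (y' - y) - P.Q (w' - w) := rfl
  have hdx : xOf (ubar (k + 1) - u k) = x' - x := rfl
  have hdy : (ubar (k + 1) - u k).fst.fst = y' - y := rfl
  have hdw : (ubar (k + 1) - u k).fst.snd = w' - w := rfl
  set g := σ • P.AQ (ubar (k + 1) - u k).fst + xOf (ubar (k + 1) - u k) with hg
  have hdx2 : x' - x = σ • P.res y w z' := by rw [h2, res]; abel
  have hg' : g = σ • P.res y' w' z' := by
    rw [hg, hAQ, hdx, hdx2]
    simp only [res, map_sub]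
    module
  have hw'2 : (1 + σ * lamQ) • w' = (σ * lamQ) • w + x' + σ • P.res y' w z' := by
    rw [h33, smul_smul, mul_one_div_cancel hc, one_smul, res]
  have hhalf : w' - whalf k = (σ / (1 + σ * lamQ)) • P.At (y' - y) := by
    rw [h33, h31, map_sub]
    module
  have heY : yOf (P.metric σ lamQ Sy (ubar (k + 1) - u k)) = P.A g
      + (σ • Sy (y' - y) + (σ ^ 2 / (1 + σ * lamQ)) • P.A (P.Q (P.At (y' - y)))) := by
    rw [yOf, fst_metric, WithLp.add_fst, P.yOf_T1 hσ hlamQ, AQt_apply, hdy]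
    rfl
  have heW : wOf (P.metric σ lamQ Sy (ubar (k + 1) - u k)) = -P.Q g
      + σ • P.Q (lamQ • (w' - w) - P.Q (w' - w)) := by
    rw [wOf, fst_metric, WithLp.add_snd, P.wOf_T1, AQt_apply, hdw]
    rfl
  refine ⟨?_, ?_, hz, zOf_metric _ _ _ _ _, ?_⟩
  · have hres : σ • P.res y' (whalf k) z'
        = g + (σ ^ 2 / (1 + σ * lamQ)) • P.Q (P.At (y' - y)) := by
      rw [hg', show whalf k = w' - (σ / (1 + σ * lamQ)) • P.At (y' - y) by rw [← hhalf]; abel]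
      simp only [res, map_sub, map_smul]
      module
    rw [hres] at hy
    rw [heY]
    convert hy using 1
    simp only [map_add, map_smul]
    abel
  · rw [heW, hg']
    have hQ := congrArg P.Q hw'2
    simp only [res, map_add, map_sub, map_smul, map_neg] at hQ ⊢
    rw [← sub_eq_zero] at hQ
    rw [← hQ]
    module
  · rw [xOf_metric, hAQ, hdx, hdx2, smul_smul, inv_mul_cancel₀ hσ.ne', one_smul]
    simp only [res, map_sub]
    abel

end CCQP

end DualHPR

/-! ### The convergence rates -/

theorem mainTheorem2 {m n : ℕ} (P : DualHPR.CCQP m n)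
    (σ lamQ : ℝ) (hσ : 0 < σ) (hlamQ : 0 < lamQ)
    (hlamQ' : ∀ μ : ℝ, Module.End.HasEigenvalue
      (P.Q : DualHPR.Vec n →ₗ[ℝ] DualHPR.Vec n) μ → μ ≤ lamQ)
    (Sy : DualHPR.Vec m →L[ℝ] DualHPR.Vec m) (hSy : Sy.IsPositive)
    (hSyA : ∀ y : DualHPR.Vec m, y ≠ 0 → 0 < inner ℝ y ((Sy + P.A ∘L P.At) y))
    (u ubar uhat : ℕ → DualHPR.USp m n) (whalf : ℕ → DualHPR.Vec n)
    (hseq : P.IsHPRSeq σ lamQ Sy u ubar uhat whalf)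
    (ustar : DualHPR.USp m n) (hstar : P.IsKKT ustar)
    (R₀ : ℝ) (hR₀ : R₀ = DualHPR.opSeminorm (P.metric σ lamQ Sy) (u 0 - ustar)) :
    ∀ k : ℕ,
      DualHPR.opSeminorm (P.metric σ lamQ Sy) (ubar (k + 1) - u k) ≤ R₀ / ((k : ℝ) + 1) ∧
      ‖P.kktResidual (ubar (k + 1))‖ ≤
        ((σ * ‖P.AQt‖ + 1) / √σ + ‖DualHPR.opSqrt (P.T1 σ lamQ Sy)‖) * (R₀ / ((k : ℝ) + 1)) ∧
      ((-(‖DualHPR.xOf ustar‖ / √σ) * (R₀ / ((k : ℝ) + 1)) : ℝ) : EReal) ≤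
        P.objError ustar (DualHPR.yOf (ubar (k + 1))) (DualHPR.wOf (ubar (k + 1)))
          (DualHPR.zOf (ubar (k + 1))) ∧
      P.objError ustar (DualHPR.yOf (ubar (k + 1))) (DualHPR.wOf (ubar (k + 1)))
          (DualHPR.zOf (ubar (k + 1))) ≤
        (((3 * R₀ + ‖DualHPR.xOf ustar‖ / √σ) * (R₀ / ((k : ℝ) + 1)) : ℝ) : EReal) := by
  have hT := P.isPositive_T1 hσ hlamQ hlamQ' hSy
  have hM := P.isPositive_metric hσ hT
  set M := P.metric σ lamQ Sy with hM_def
  have hpert : ∀ k, P.IsPerturbedKKT (ubar (k + 1)) (M (ubar (k + 1) - u k)) :=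
    hseq.isPerturbedKKT hσ hlamQ hSy
  have hstar' := hstar.isPerturbedKKT
  have hmap : ∀ k, DualHPR.opSqrt M (u k) - DualHPR.opSqrt M (ubar (k + 1))
      = DualHPR.opSqrt M (-(ubar (k + 1) - u k)) := by
    intro k
    rw [neg_sub, map_sub]
  -- The square root of `M` maps the iterates to a Halpern iteration in a Hilbert space.
  have hhalpern := DualHPR.halpern_bounds (a := fun k => DualHPR.opSqrt M (u k))
    (b := fun k => DualHPR.opSqrt M (ubar (k + 1))) (p := DualHPR.opSqrt M ustar)
    (fun k => by
      rw [hseq.step5 k, hseq.step4 k]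
      simp only [map_add, map_sub, map_smul])
    (fun i j => by
      have h := (hpert i).inner_sub_nonpos (hpert j)
      simp only [hmap]
      rw [← map_sub, ← map_sub, DualHPR.inner_opSqrt_opSqrt hM, map_sub, map_neg, map_neg,
        ← neg_sub', inner_neg_left]
      linarith)
    (fun i => by
      have h := (hpert i).inner_sub_nonpos hstar'
      simp only [hmap]
      rw [← map_sub, DualHPR.inner_opSqrt_opSqrt hM, map_neg, inner_neg_left]
      rw [sub_zero] at h
      linarith)
  intro k
  obtain ⟨h1, h2⟩ := hhalpern k
  have hR : ‖DualHPR.opSqrt M (u 0) - DualHPR.opSqrt M ustar‖ = R₀ := by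
    rw [hR₀, DualHPR.opSeminorm_eq_norm_opSqrt hM, map_sub]
  simp only [hR] at h1 h2
  rw [← map_sub, ← DualHPR.opSeminorm_eq_norm_opSqrt hM] at h2
  rw [norm_sub_rev, ← map_sub, ← DualHPR.opSeminorm_eq_norm_opSqrt hM] at h1
  set d := ubar (k + 1) - u k with hd
  set ε := R₀ / ((k : ℝ) + 1) with hε
  have hR₀_nonneg : 0 ≤ R₀ := hR ▸ norm_nonneg _
  have hs : 0 < √σ := Real.sqrt_pos.mpr hσ
  have hex : ‖DualHPR.xOf (M d)‖ ≤ ε / √σ :=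
    (P.norm_xOf_metric_le hσ hT d).trans (by gcongr)
  have hxx : |inner ℝ (DualHPR.xOf ustar) (DualHPR.xOf (M d))|
      ≤ ‖DualHPR.xOf ustar‖ / √σ * ε := by
    refine (abs_real_inner_le_norm _ _).trans ?_
    calc _ ≤ ‖DualHPR.xOf ustar‖ * (ε / √σ) := by gcongr
      _ = _ := by ring
  obtain ⟨r, hr⟩ := (hpert k).exists_dualObj_eq
  obtain ⟨s, hsr⟩ := hstar'.exists_dualObj_eq
  have hobj : P.objError ustar (DualHPR.yOf (ubar (k + 1))) (DualHPR.wOf (ubar (k + 1)))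
      (DualHPR.zOf (ubar (k + 1))) = ((r - s : ℝ) : EReal) := by
    rw [DualHPR.CCQP.objError, hr, hsr, EReal.coe_sub]
  refine ⟨h1, ?_, ?_, ?_⟩
  · refine (hpert k).norm_kktResidual_le.trans ?_
    calc _ ≤ (‖P.AQt‖ * √σ + ‖DualHPR.opSqrt (P.T1 σ lamQ Sy)‖) * ε + ε / √σ := by
          refine add_le_add ((P.norm_fst_metric_le hσ hT d).trans ?_) hex
          gcongr
      _ = _ := by
          have h3 : (σ * ‖P.AQt‖ + 1) / √σ = ‖P.AQt‖ * √σ + 1 / √σ := by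
            rw [add_div]
            congr 1
            rw [div_eq_iff hs.ne', mul_assoc, Real.mul_self_sqrt hσ.le, mul_comm]
          rw [h3]
          ring
  · rw [hobj, EReal.coe_le_coe_iff]
    have h3 := hstar'.dualObj_le (hpert k) hsr hr
    rw [inner_zero_left, DualHPR.xOf_zero, inner_zero_right] at h3
    have := (abs_le.mp hxx).2
    linarith
  · rw [hobj, EReal.coe_le_coe_iff]
    have h3 := (hpert k).dualObj_le hstar' hr hsr
    rw [DualHPR.xOf_zero, inner_zero_right, ← neg_sub (ubar (k + 1)) ustar, inner_neg_right] at h3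
    have h4 := (abs_le.mp hxx).1
    have h5 := (abs_le.mp (DualHPR.abs_inner_le_opSeminorm_mul hM d (ubar (k + 1) - ustar))).1
    have h6 : DualHPR.opSeminorm M d * DualHPR.opSeminorm M (ubar (k + 1) - ustar) ≤ ε * R₀ :=
      mul_le_mul h1 h2 (Real.sqrt_nonneg _) (by positivity)
    have h7 : 0 ≤ R₀ * ε := by positivity
    linarith
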